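/- A Roman dominating function (rdf) of a finite simple graph $G=(V,E)$ is a function $f\colon V\to\{0,1,2\}$ such that every vertex $v$ with $f(v)=0$ has a neighbor $u$ with $f(u)=2$. An rdf $f$ is minimal if there is no rdf $g\neq f$ with $g(v)\le f(v)$ for all $v\in V$. A graph is chordal if it has no induced cycle of length at least four. Theorem. There is an algorithm which, given a chordal graph $G$ of order $n$ (on the vertex set $\{0,\dots,n-1\}$, by its adjacency matrix), prints all minimal Roman dominating functions of $G$, each exactly once and nothing else, and halts, such that 1. the total running time is $\mathcal{O}(1.8940^n)$; 2. the delay is polynomial: the time before the first output, the time between any two consecutive outputs, and the time from the last output until the algorithm halts are all at most $p(n)$ for a fixed polynomial $p$; 3. the space used is at most $q(n)$ for a fixed polynomial $q$. Here an algorithm is one fixed program for a random access machine with addition and truncated subtraction on natural numbers, assignments, indirect addressing in arrays, conditionals and while-loops, each assignment, store, test and no-op taking one time step, and the printing of an item of length $\ell$ taking $\ell+1$ time steps. Space at most $b$ means that after every time step every stored number has at most $b$ bits and all array cells with a nonzero entry have address less than $b$. -/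

import Mathlib

namespace RomanEnum

/-! ### Chordal graphs and minimal Roman dominating functions -/

/-- A graph is chordal if it has no induced cycle of length at least four. -/
def IsChordal {V : Type*} (G : SimpleGraph V) : Prop :=
  ∀ k : ℕ, 4 ≤ k → ¬ SimpleGraph.IsIndContained (SimpleGraph.cycleGraph k) G

/-- `f : V → {0, 1, 2}` is a Roman dominating function of `G`: every vertex of value `0` has a
neighbor of value `2`. -/
def IsRDF {V : Type*} (G : SimpleGraph V) (f : V → Fin 3) : Prop :=
  ∀ v, f v = 0 → ∃ u, G.Adj v u ∧ f u = 2

/-- A minimal Roman dominating function: an rdf that is minimal among all rdf with respect to the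
pointwise order on functions `V → {0, 1, 2}`. -/
def IsMinimalRDF {V : Type*} (G : SimpleGraph V) (f : V → Fin 3) : Prop :=
  Minimal (IsRDF G) f

/-! ### The machine model

A random access machine with unit cost instructions, programmed by a structured program. The memory
consists of scalar registers and of arrays with indirect addressing, all holding natural numbers;
a given program mentions only finitely many registers and arrays. The only arithmetic operations
are addition and truncated subtraction (in particular there is no unit cost multiplication). -/

/-- The memory of the machine: register `x` holds `var x`, cell `i` of array `a` holds `arr a i`. -/
structure State where
  var : ℕ → ℕ
  arr : ℕ → ℕ → ℕ

/-- Overwrite register `x` with the value `k`. -/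
def State.setVar (s : State) (x k : ℕ) : State :=
  { s with var := Function.update s.var x k }

/-- Overwrite cell `i` of array `a` with the value `k`. -/
def State.setArr (s : State) (a i k : ℕ) : State :=
  { s with arr := Function.update s.arr a (Function.update (s.arr a) i k) }

/-- Expressions: constants, registers, array cells, sums and truncated differences. -/
inductive Expr where
  | const (k : ℕ)
  | var (x : ℕ)
  | read (a : ℕ) (e : Expr)
  | add (e₁ e₂ : Expr)
  | sub (e₁ e₂ : Expr)

/-- The value of an expression. -/
def Expr.eval (s : State) : Expr → ℕ
  | .const k => k
  | .var x => s.var x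
  | .read a e => s.arr a (e.eval s)
  | .add e₁ e₂ => e₁.eval s + e₂.eval s
  | .sub e₁ e₂ => e₁.eval s - e₂.eval s

/-- Programs. Tests succeed on nonzero values; `output a e` prints the first `e` entries of the
array `a` as one item of the output. -/
inductive Program where
  | skip
  | assign (x : ℕ) (e : Expr)
  | store (a : ℕ) (i e : Expr)
  | output (a : ℕ) (e : Expr)
  | seq (p q : Program)
  | cond (e : Expr) (p q : Program)
  | loop (e : Expr) (p : Program)

/-- The observable events of a run: one time step (with the contents of the memory after this step),
or the completion of an output item. -/
inductive Event where
  | tick (s : State)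
  | item (w : List ℕ)

/-- `Exec p s t s'`: started in memory `s`, the program `p` halts, with memory `s'`, and `t` is the
sequence of events of the run. Every assignment, every store, every `skip` and every test takes one
time step; printing an item of length `l` takes `l + 1` time steps. -/
inductive Exec : Program → State → List Event → State → Prop
  | skip (s : State) : Exec .skip s [.tick s] s
  | assign (s : State) (x : ℕ) (e : Expr) :
      Exec (.assign x e) s [.tick (s.setVar x (e.eval s))] (s.setVar x (e.eval s))
  | store (s : State) (a : ℕ) (i e : Expr) :
      Exec (.store a i e) s [.tick (s.setArr a (i.eval s) (e.eval s))]
        (s.setArr a (i.eval s) (e.eval s))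
  | output (s : State) (a : ℕ) (e : Expr) :
      Exec (.output a e) s
        (List.replicate (e.eval s + 1) (.tick s) ++
          [.item ((List.range (e.eval s)).map (s.arr a))]) s
  | seq {p q : Program} {s s' s'' : State} {t t' : List Event} :
      Exec p s t s' → Exec q s' t' s'' → Exec (.seq p q) s (t ++ t') s''
  | condTrue {e : Expr} {p q : Program} {s s' : State} {t : List Event} :
      e.eval s ≠ 0 → Exec p s t s' → Exec (.cond e p q) s (.tick s :: t) s'
  | condFalse {e : Expr} {p q : Program} {s s' : State} {t : List Event} :
      e.eval s = 0 → Exec q s t s' → Exec (.cond e p q) s (.tick s :: t) s'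
  | loopDone {e : Expr} {p : Program} {s : State} :
      e.eval s = 0 → Exec (.loop e p) s [.tick s] s
  | loopStep {e : Expr} {p : Program} {s s' s'' : State} {t t' : List Event} :
      e.eval s ≠ 0 → Exec p s t s' → Exec (.loop e p) s' t' s'' →
        Exec (.loop e p) s (.tick s :: (t ++ t')) s''

/-- The machine is deterministic, so that one may speak of *the* run of a program. -/
theorem Exec.deterministic {p : Program} {s s₁ s₂ : State} {t₁ t₂ : List Event}
    (h₁ : Exec p s t₁ s₁) (h₂ : Exec p s t₂ s₂) : t₁ = t₂ ∧ s₁ = s₂ := by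
  induction h₁ generalizing t₂ s₂ with
  | skip | assign | store | output => cases h₂; exact ⟨rfl, rfl⟩
  | seq _ _ ih ih' =>
    cases h₂ with
    | seq a b =>
      obtain ⟨rfl, rfl⟩ := ih a
      obtain ⟨rfl, rfl⟩ := ih' b
      exact ⟨rfl, rfl⟩
  | condTrue h _ ih =>
    cases h₂ with
    | condTrue _ a =>
      obtain ⟨rfl, rfl⟩ := ih a
      exact ⟨rfl, rfl⟩
    | condFalse h' _ => exact absurd h' h
  | condFalse h _ ih =>
    cases h₂ with
    | condTrue h' _ => exact absurd h h'
    | condFalse _ a =>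
      obtain ⟨rfl, rfl⟩ := ih a
      exact ⟨rfl, rfl⟩
  | loopDone h =>
    cases h₂ with
    | loopDone _ => exact ⟨rfl, rfl⟩
    | loopStep h' _ _ => exact absurd h h'
  | loopStep h _ _ ih ih' =>
    cases h₂ with
    | loopDone h' => exact absurd h' h
    | loopStep _ a b =>
      obtain ⟨rfl, rfl⟩ := ih a
      obtain ⟨rfl, rfl⟩ := ih' b
      exact ⟨rfl, rfl⟩

/-- The items printed during a run, in their order. -/
def outputs : List Event → List (List ℕ)
  | [] => []
  | .tick _ :: t => outputs t
  | .item w :: t => w :: outputs t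

/-- The running time: the number of time steps of a run. -/
def time : List Event → ℕ
  | [] => 0
  | .tick _ :: t => time t + 1
  | .item _ :: t => time t

/-- The delays of a run: the numbers of time steps before the first printed item, between any two
consecutive printed items, and after the last printed item. The argument `k` counts the time steps
since the last printed item (or since the start). -/
def delays (k : ℕ) : List Event → List ℕ
  | [] => [k]
  | .tick _ :: t => delays (k + 1) t
  | .item _ :: t => k :: delays 0 t

/-- The memory contents fit into space `b`: every number stored has at most `b` bits, and in every
array only cells with address below `b` are in use. As a program has a fixed number of registers
and arrays, this bounds the total number of bits in use by a constant times `b * b`. -/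
def State.FitsIn (s : State) (b : ℕ) : Prop :=
  (∀ x, (s.var x).size ≤ b) ∧ ∀ a i, s.arr a i ≠ 0 → i < b ∧ (s.arr a i).size ≤ b

/-- A run uses space at most `b`: the memory contents fit into space `b` after every time step. -/
def SpaceAtMost (t : List Event) (b : ℕ) : Prop :=
  ∀ s, Event.tick s ∈ t → s.FitsIn b

/-! ### Input and output -/

open Classical in
/-- The initial memory for a graph `G` with vertices `0, …, n - 1`: register `0` holds `n`,
array `0` holds the adjacency matrix of `G`, row by row, and everything else is `0`. -/
noncomputable def inputState {n : ℕ} (G : SimpleGraph (Fin n)) : State where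
  var x := if x = 0 then n else 0
  arr a i := if a = 0 ∧ ∃ u v : Fin n, i = u.val * n + v.val ∧ G.Adj u v then 1 else 0

/-- A function `f : {0, …, n - 1} → {0, 1, 2}` is printed as the list of its values. -/
def encode {n : ℕ} (f : Fin n → Fin 3) : List ℕ :=
  List.ofFn fun v => (f v).val

/-- The list `L` of printed items enumerates the minimal Roman dominating functions of `G`: it
contains each of them exactly once, and nothing else. -/
def EnumeratesMinimalRDFs {n : ℕ} (G : SimpleGraph (Fin n)) (L : List (List ℕ)) : Prop :=
  L.Nodup ∧ ∀ w, w ∈ L ↔ ∃ f : Fin n → Fin 3, IsMinimalRDF G f ∧ encode f = w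

end RomanEnum

/-! A minimal Roman dominating function `f` is determined by the set `A` of vertices of value 2. It
takes the value 0 exactly on the vertices outside `A` with a neighbor in `A`, and minimality means
that every element of `A` has a private neighbor outside `A`. Conversely every such `A` arises, so
`rdfOf` is a bijection from the sets satisfying `HasPrivateNeighbors` onto the functions to be
printed (`isMinimalRDF_rdfOf`, `IsMinimalRDF.exists_rdfOf`). This holds in every graph.

The property passes to subsets (`HasPrivateNeighbors.mono`). Backtracking over the vertices
therefore has no dead ends: every set accepted by the test is itself an output, and a rejected set
has no admissible superset. At most `n` steps without output separate two outputs, each step costs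
one quadratic test, and the memory holds little more than the adjacency matrix
(`exists_list_yields_enumerate`).

Chordality enters only in the count: there are at most `1.89 ^ n` such sets
(`IsChordal.card_hasPrivateNeighbors_le`). The proof branches on the first undecided vertex of a
perfect elimination order. Undecided vertices weigh 1.89, and rejected vertices that may still serve
as private neighbors weigh 5/4. The running time is at most the number of delays times the maximal
delay, and the polynomial factor disappears in the gap between 1.89 and 1.894. -/

namespace RomanEnum

/-! ### Perfect elimination orders of chordal graphs -/

section Chordal

variable {V : Type*}

theorem cycleGraph_adj_of_lt {k : ℕ} {i j : Fin k} (h : i < j) :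
    (SimpleGraph.cycleGraph k).Adj i j ↔ j.val = i.val + 1 ∨ (i.val = 0 ∧ j.val + 1 = k) := by
  have hj := j.isLt
  have h' : i.val < j.val := h
  rw [SimpleGraph.cycleGraph_adj', Fin.coe_sub_iff_lt.mpr h, Fin.coe_sub_iff_le.mpr h.le]
  omega

/-- An injective sequence of `k` vertices that is adjacent exactly at consecutive positions
and at its ends yields an induced cycle. -/
theorem cycleGraph_isIndContained {G : SimpleGraph V} {k : ℕ} (p : ℕ → V)
    (hp : ∀ i j, i < j → j < k → p i ≠ p j ∧
      (G.Adj (p i) (p j) ↔ j = i + 1 ∨ (i = 0 ∧ j + 1 = k))) :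
    SimpleGraph.IsIndContained (SimpleGraph.cycleGraph k) G := by
  refine ⟨⟨⟨fun i => p i.val, ?_⟩, ?_⟩⟩
  · intro i j hij
    by_contra hne
    rcases lt_or_gt_of_ne hne with h | h
    · exact (hp _ _ h j.isLt).1 hij
    · exact (hp _ _ h i.isLt).1 hij.symm
  · intro i j
    change G.Adj (p i.val) (p j.val) ↔ _
    rcases lt_trichotomy i j with h | h | h
    · rw [(hp _ _ h j.isLt).2, cycleGraph_adj_of_lt h]
    · subst h; simp
    · rw [G.adj_comm, (hp _ _ h i.isLt).2, SimpleGraph.adj_comm, cycleGraph_adj_of_lt h]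

/-- Two nonadjacent vertices attached to a connected set are joined by an induced path with all
inner vertices in that set. -/
theorem exists_induced_path {G : SimpleGraph V} {H : Set V} (hH : (G.induce H).Preconnected)
    {s t a b : V} (hs : s ∉ H) (ht : t ∉ H) (hst : s ≠ t) (hadj : ¬ G.Adj s t)
    (ha : a ∈ H) (hb : b ∈ H) (hsa : G.Adj s a) (hbt : G.Adj b t) :
    ∃ (L : ℕ) (p : ℕ → V), 2 ≤ L ∧ p 0 = s ∧ p L = t ∧ (∀ i, 0 < i → i < L → p i ∈ H) ∧
      ∀ i j, i < j → j ≤ L → p i ≠ p j ∧ (G.Adj (p i) (p j) ↔ j = i + 1) := by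
  classical
  -- A shortest walk from `s` to `t` through `H` is taken; minimality makes it an induced path.
  let Q : ℕ → Prop := fun L => ∃ p : ℕ → V, p 0 = s ∧ p L = t ∧
    (∀ i, 0 < i → i < L → p i ∈ H) ∧ ∀ i < L, G.Adj (p i) (p (i + 1))
  have hQ : ∃ L, Q L := by
    obtain ⟨w⟩ := hH ⟨a, ha⟩ ⟨b, hb⟩
    refine ⟨w.length + 2, fun i => if i = 0 then s else if i = w.length + 2 then t else
      (w.getVert (i - 1)).val, by simp, by simp, ?_, ?_⟩
    · intro i h0 h1
      simp [h0.ne', h1.ne]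
    · intro i hi
      rcases Nat.eq_zero_or_pos i with rfl | h0
      · simpa using hsa
      · obtain ⟨i, rfl⟩ := Nat.exists_eq_add_of_lt h0
        by_cases h1 : i = w.length
        · subst h1; simpa using hbt
        · have := w.adj_getVert_succ (i := i) (by omega)
          have e1 : ¬ (i = w.length + 1) := by omega
          simpa [e1, h1] using this
  obtain ⟨p, h0, hL, hin, hp⟩ := Nat.find_spec hQ
  have hmin : ∀ m, Q m → Nat.find hQ ≤ m := fun m => Nat.find_min' hQ
  generalize Nat.find hQ = L at *
  -- A chord would permit skipping the `j - i - 1` vertices strictly between its ends.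
  have key : ∀ i j, i + 1 < j → j ≤ L → ¬ G.Adj (p i) (p j) := by
    intro i j hij hj hA
    have := hmin (L - (j - i - 1)) ⟨fun k => if k ≤ i then p k else p (k + (j - i - 1)), by
      simp [h0], ?_, ?_, ?_⟩
    · omega
    · dsimp only
      rw [if_neg (by omega), ← hL]; congr 1; omega
    · intro k hk hk'
      dsimp only
      split_ifs with h
      · exact hin _ hk (by omega)
      · exact hin _ (by omega) (by omega)
    · intro k hk
      dsimp only
      rcases lt_trichotomy k i with h | h | h
      · rw [if_pos h.le, if_pos (by omega)]; exact hp _ (by omega)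
      · subst h
        rw [if_pos le_rfl, if_neg (by omega)]
        convert hA using 2; omega
      · rw [if_neg (by omega), if_neg (by omega)]
        convert hp (k + (j - i - 1)) (by omega) using 2; omega
  have hL2 : 2 ≤ L := by
    rcases L with _ | _ | L
    · exact absurd (h0.symm.trans hL) hst
    · have := hp 0 (by omega)
      rw [h0] at this
      simp only [zero_add] at this hL
      rw [hL] at this
      exact absurd this hadj
    · omega
  refine ⟨L, p, hL2, h0, hL, hin, fun i j hij hj => ⟨fun he => ?_, fun hA => ?_, ?_⟩⟩
  · rcases hj.lt_or_eq with h | h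
    · exact key i (j + 1) (by omega) h (he ▸ hp j h)
    · subst h
      rcases Nat.eq_zero_or_pos i with rfl | h0'
      · exact hst (h0.symm.trans (he.trans hL))
      · exact ht (hL ▸ he ▸ hin i h0' hij)
  · by_contra hne
    exact key i j (by omega) hj hA
  · rintro rfl
    exact hp _ (by omega)

/-- In a chordal graph, the common neighbors of a vertex and of a connected set not adjacent to it
are pairwise adjacent. -/
theorem IsChordal.adj_of_separates {G : SimpleGraph V} (hG : IsChordal G) {H : Set V}
    (hH : (G.induce H).Preconnected) {r s t a b : V} (hr : r ∉ H) (hrH : ∀ h ∈ H, ¬ G.Adj r h)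
    (hs : s ∉ H) (ht : t ∉ H) (hrs : G.Adj r s) (hrt : G.Adj r t) (hst : s ≠ t)
    (ha : a ∈ H) (hb : b ∈ H) (hsa : G.Adj s a) (htb : G.Adj t b) : G.Adj s t := by
  by_contra hadj
  obtain ⟨L, p, hL2, h0, hL, hin, hp⟩ :=
    exists_induced_path hH hs ht hst hadj ha hb hsa htb.symm
  -- Were `s` and `t` nonadjacent, `r` would close the induced path through `H` to an induced cycle
  -- on `L + 2 ≥ 4` vertices.
  refine hG (L + 2) (by omega) (cycleGraph_isIndContained
    (fun i => if i ≤ L then p i else r) ?_)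
  intro i j hij hj
  have hi : i ≤ L := by omega
  simp only [if_pos hi]
  by_cases hjL : j ≤ L
  · rw [if_pos hjL]
    refine ⟨(hp i j hij hjL).1, (hp i j hij hjL).2.trans ⟨Or.inl, ?_⟩⟩
    rintro (h | h)
    · exact h
    · omega
  · rw [if_neg hjL]
    obtain rfl : j = L + 1 := by omega
    rcases Nat.eq_zero_or_pos i with rfl | hi0
    · rw [h0]; exact ⟨hrs.ne', by simp [hrs.symm]⟩
    · rcases hi.lt_or_eq with h | h
      · have hm := hin i hi0 h
        refine ⟨fun he => hr (he ▸ hm), ?_⟩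
        have : ¬ G.Adj (p i) r := fun h' => hrH _ hm h'.symm
        simp only [this, false_iff]
        omega
      · subst h
        rw [hL]; exact ⟨hrt.ne', by simp [hrt.symm]⟩

theorem IsChordal.induce {G : SimpleGraph V} (hG : IsChordal G) (s : Set V) :
    IsChordal (G.induce s) :=
  fun k hk h => hG k hk (h.trans ⟨SimpleGraph.Embedding.induce s⟩)

/-- A nonempty finite chordal graph has a simplicial vertex. -/
theorem IsChordal.exists_simplicial [Finite V] [Nonempty V] {G : SimpleGraph V}
    (hG : IsChordal G) : ∃ v, G.IsClique (G.neighborSet v) := by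
  induction hn : Nat.card V using Nat.strong_induction_on generalizing V with
  | _ n ih =>
  subst hn
  -- For a maximal `H` in `F`, let `R` be the set of vertices outside `H` without neighbors in `H`.
  -- A simplicial vertex of the smaller graph induced on `R` is simplicial in `G`: its neighbors
  -- outside `R` all have neighbors in `H`, so they are pairwise adjacent by
  -- `IsChordal.adj_of_separates`, and by maximality of `H` they are adjacent to all of `R`.
  let F : Set (Set V) := {H | (G.induce H).Connected ∧ ∃ r, r ∉ H ∧ ∀ h ∈ H, ¬ G.Adj r h}
  by_cases hF : F.Nonempty
  · obtain ⟨H, ⟨⟨hHc, r, hrH, hr⟩, hmax⟩⟩ := F.toFinite.exists_maximal hF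
    let R : Set V := {r | r ∉ H ∧ ∀ h ∈ H, ¬ G.Adj r h}
    obtain ⟨⟨h₀, hh₀⟩⟩ := hHc.nonempty
    have hcard : Nat.card R < Nat.card V := by
      rw [Nat.card_coe_set_eq, ← Set.ncard_univ]
      exact Set.ncard_lt_ncard (Set.ssubset_univ_iff.mpr fun h =>
        (show h₀ ∈ R from h ▸ Set.mem_univ _).1 hh₀)
    have : Nonempty R := ⟨⟨r, hrH, hr⟩⟩
    obtain ⟨⟨v, hv⟩, hvs⟩ := ih _ hcard (hG.induce R) rfl
    have hS : ∀ s, s ∉ H → s ∉ R → ∀ r ∈ R, G.Adj r s := by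
      intro s hs hsR r hrR
      by_contra hna
      have : ∃ h ∈ H, G.Adj s h := by
        by_contra hc
        push Not at hc
        exact hsR ⟨hs, hc⟩
      obtain ⟨h, hh, hsh⟩ := this
      -- If `s` missed some `r ∈ R`, then `H` together with `s` would still be connected and avoid
      -- `r`.
      have hins : insert s H ∈ F := by
        refine ⟨?_, r, ?_, ?_⟩
        · have := SimpleGraph.connected_induce_union (s := {s}) (t := H)
            (by rw [G.induce_singleton_eq_top s]; exact SimpleGraph.connected_top.preconnected)
            hHc.preconnected
            (Set.mem_singleton s) hh hsh
          rwa [Set.singleton_union] at this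
        · rintro (rfl | h')
          · exact hsR hrR
          · exact hrR.1 h'
        · rintro x (rfl | h')
          · exact hna
          · exact hrR.2 x h'
      exact hs (hmax hins (Set.subset_insert s H) (Set.mem_insert s H))
    refine ⟨v, fun x hx y hy hxy => ?_⟩
    have hvx : G.Adj v x := hx
    have hvy : G.Adj v y := hy
    have hxH : x ∉ H := fun h => hv.2 x h hvx
    have hyH : y ∉ H := fun h => hv.2 y h hvy
    by_cases hxR : x ∈ R
    · by_cases hyR : y ∈ R
      · exact hvs (show (⟨x, hxR⟩ : R) ∈ (G.induce R).neighborSet ⟨v, hv⟩ from hvx)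
          (show (⟨y, hyR⟩ : R) ∈ (G.induce R).neighborSet ⟨v, hv⟩ from hvy)
          (fun h => hxy (congrArg Subtype.val h))
      · exact hS y hyH hyR x hxR
    · by_cases hyR : y ∈ R
      · exact (hS x hxH hxR y hyR).symm
      · have hx' : ∃ h ∈ H, G.Adj x h := by
          by_contra hc
          push Not at hc
          exact hxR ⟨hxH, hc⟩
        have hy' : ∃ h ∈ H, G.Adj y h := by
          by_contra hc
          push Not at hc
          exact hyR ⟨hyH, hc⟩
        obtain ⟨a, ha, hxa⟩ := hx'
        obtain ⟨b, hb, hyb⟩ := hy'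
        exact hG.adj_of_separates hHc.preconnected hv.1 hv.2 hxH hyH hvx hvy hxy ha hb hxa hyb
  -- If `F` is empty the graph is complete, since a singleton `{x}` with a nonneighbor of `x` would
  -- belong to `F`.
  · refine ⟨Classical.arbitrary V, fun x _ y _ hxy => ?_⟩
    by_contra hna
    refine hF ⟨{x}, by rw [G.induce_singleton_eq_top x]; exact SimpleGraph.connected_top, y,
      fun h => hxy h.symm, ?_⟩
    rintro h rfl h'
    exact hna h'.symm

/-- `r` ranks the vertices of `W` along a perfect elimination order of the subgraph induced
by `W`. -/
def IsPerfectElimination (G : SimpleGraph V) (W : Set V) (r : V → ℕ) : Prop :=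
  Set.InjOn r W ∧ ∀ v ∈ W, ∀ x ∈ W, ∀ y ∈ W, r v < r x → r v < r y →
    G.Adj v x → G.Adj v y → x ≠ y → G.Adj x y

theorem IsChordal.exists_isPerfectElimination [Finite V] {G : SimpleGraph V} (hG : IsChordal G)
    (W : Set V) : ∃ r, IsPerfectElimination G W r := by
  classical
  induction hn : W.ncard generalizing W with
  | zero =>
    obtain rfl : W = ∅ := (Set.ncard_eq_zero W.toFinite).mp hn
    exact ⟨fun _ => 0, by simp [IsPerfectElimination]⟩
  | succ n ih =>
    have : Nonempty W := by
      rw [Set.nonempty_coe_sort, ← Set.ncard_pos W.toFinite]; omega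
    obtain ⟨⟨v, hv⟩, hvs⟩ := (hG.induce W).exists_simplicial
    obtain ⟨r, hinj, hr⟩ := ih (W \ {v}) (by
      rw [Set.ncard_sdiff_singleton_of_mem hv, hn]; rfl)
    refine ⟨fun x => if x = v then 0 else r x + 1, ?_, ?_⟩
    · intro x hx y hy hxy
      dsimp only at hxy
      split_ifs at hxy with h1 h2 h2
      · rw [h1, h2]
      · exact hinj ⟨hx, h1⟩ ⟨hy, h2⟩ (by omega)
    · intro u hu x hx y hy hux huy hax hay hxy
      have hxv : x ≠ v := by rintro rfl; simp at hux
      have hyv : y ≠ v := by rintro rfl; simp at huy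
      by_cases huv : u = v
      · subst huv
        exact hvs (show (⟨x, hx⟩ : W) ∈ (G.induce W).neighborSet ⟨u, hv⟩ from hax)
          (show (⟨y, hy⟩ : W) ∈ (G.induce W).neighborSet ⟨u, hv⟩ from hay)
          (fun h => hxy (congrArg Subtype.val h))
      · simp only [if_neg huv, if_neg hxv, if_neg hyv] at hux huy
        exact hr u ⟨hu, huv⟩ x ⟨hx, hxv⟩ y ⟨hy, hyv⟩ (by omega) (by omega) hax hay hxy

end Chordal

/-! ### Counting sets with external private neighbors -/

section Counting

variable {V : Type*} [DecidableEq V]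

/-- Every element of `A` has a private neighbor in `U`, that is, a vertex of `U` outside `A`
that has no other neighbor in `A`. -/
def HasPrivateNeighbors (G : SimpleGraph V) (U A : Finset V) : Prop :=
  ∀ a ∈ A, ∃ u ∈ U, u ∉ A ∧ ∀ w ∈ A, G.Adj u w ↔ w = a

open Classical in
/-- The sets of vertices in `C` all of whose elements have private neighbors in `C ∪ P`. -/
noncomputable def privateFamily (G : SimpleGraph V) (C P : Finset V) : Finset (Finset V) :=
  C.powerset.filter (HasPrivateNeighbors G (C ∪ P))

variable {G : SimpleGraph V} {C P A : Finset V}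

theorem mem_privateFamily :
    A ∈ privateFamily G C P ↔ A ⊆ C ∧ HasPrivateNeighbors G (C ∪ P) A := by
  simp [privateFamily]

/-- A rejected candidate may still serve as a private neighbor, so it moves from `C` to `P`. -/
theorem mem_privateFamily_erase_insert {a : V} (hA : A ∈ privateFamily G C P) (ha : a ∉ A) :
    A ∈ privateFamily G (C.erase a) (insert a P) := by
  rw [mem_privateFamily] at *
  refine ⟨fun x hx => Finset.mem_erase.mpr ⟨by rintro rfl; exact ha hx, hA.1 hx⟩, fun x hx => ?_⟩
  obtain ⟨u, hu, h⟩ := hA.2 x hx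
  refine ⟨u, ?_, h⟩
  by_cases hua : u = a <;> simp_all

theorem mem_privateFamily_erase_right {s : V} (hA : A ∈ privateFamily G C P)
    (hs : ∀ w ∈ C, ¬ G.Adj s w) : A ∈ privateFamily G C (P.erase s) := by
  rw [mem_privateFamily] at *
  refine ⟨hA.1, fun x hx => ?_⟩
  obtain ⟨u, hu, hu', h⟩ := hA.2 x hx
  refine ⟨u, ?_, hu', h⟩
  have : u ≠ s := by
    rintro rfl
    exact hs x (hA.1 hx) ((h x hx).mpr rfl)
  simp_all

-- Once `a` is chosen, its neighbors are private for no other element. So those in `P` can be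
-- discarded, and those in `E` leave `C` without entering `P`.
open Classical in
theorem erase_mem_privateFamily {a : V} {E : Finset V} (hA : A ∈ privateFamily G C P)
    (ha : a ∈ A) (hE : ∀ e ∈ E, e ∉ A ∧ G.Adj a e) :
    A.erase a ∈ privateFamily G (C.erase a \ E) (P.filter fun s => ¬ G.Adj a s) := by
  rw [mem_privateFamily] at *
  refine ⟨fun x hx => ?_, fun x hx => ?_⟩
  · rw [Finset.mem_erase] at hx
    simp only [Finset.mem_sdiff, Finset.mem_erase]
    exact ⟨⟨hx.1, hA.1 hx.2⟩, fun h => (hE x h).1 hx.2⟩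
  · rw [Finset.mem_erase] at hx
    obtain ⟨u, hu, hu', h⟩ := hA.2 x hx.2
    have hau : ¬ G.Adj a u := fun h' => hx.1 ((h a ha).mp h'.symm).symm
    refine ⟨u, ?_, fun h' => hu' (Finset.mem_of_mem_erase h'),
      fun w hw => h w (Finset.mem_of_mem_erase hw)⟩
    have hua : u ≠ a := by rintro rfl; exact hu' ha
    have huE : u ∉ E := fun h' => hau (hE u h').2
    simp only [Finset.mem_union, Finset.mem_sdiff, Finset.mem_erase, Finset.mem_filter] at hu ⊢
    tauto

theorem card_privateFamily_le_add {a : V} {C₁ P₁ C₂ P₂ : Finset V}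
    (h₁ : ∀ A ∈ privateFamily G C P, a ∉ A → A ∈ privateFamily G C₁ P₁)
    (h₂ : ∀ A ∈ privateFamily G C P, a ∈ A → A.erase a ∈ privateFamily G C₂ P₂) :
    ((privateFamily G C P).card : ℝ) ≤
      (privateFamily G C₁ P₁).card + (privateFamily G C₂ P₂).card := by
  norm_cast
  rw [← Finset.card_filter_add_card_filter_not (fun A => a ∉ A)]
  refine add_le_add (Finset.card_le_card fun A hA => ?_)
    (Finset.card_le_card_of_injOn (fun A => A.erase a) (fun A hA => ?_) ?_)
  · rw [Finset.mem_filter] at hA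
    exact h₁ A hA.1 hA.2
  · rw [Finset.mem_coe, Finset.mem_filter, not_not] at hA
    exact h₂ A hA.1 hA.2
  · intro A hA B hB hAB
    simp only [Finset.coe_filter, not_not, Set.mem_ofPred_eq] at hA hB
    rw [← Finset.insert_erase hA.2, ← Finset.insert_erase hB.2]
    exact congrArg (insert a) hAB

/-- A neighbor `b` of `a` that dominates all potential private neighbors of `a` cannot be
chosen together with `a`. -/
theorem notMem_of_dominates_neighbors {a b : V} (hA : A ∈ privateFamily G C P) (ha : a ∈ A)
    (hab : G.Adj a b) (h : ∀ u ∈ C ∪ P, G.Adj a u → u = b ∨ G.Adj u b) : b ∉ A := by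
  intro hb
  obtain ⟨u, hu, hu', hp⟩ := (mem_privateFamily.mp hA).2 a ha
  rcases h u hu ((hp a ha).mpr rfl).symm with rfl | hub
  · exact hu' hb
  · exact hab.ne ((hp b hb).mp hub).symm

open Classical in
/-- The structure around the first vertex of `C` in a perfect elimination order. -/
theorem IsPerfectElimination.first_vertex_cases {r : V → ℕ}
    (hr : IsPerfectElimination G Set.univ r) {a : V} (hmin : ∀ b ∈ C, r a ≤ r b) :
    (∀ w ∈ C, ¬ G.Adj a w) ∨
    2 ≤ (P.filter (G.Adj a)).card ∨
    (∃ s ∈ P, G.Adj a s ∧ ∀ w ∈ C.erase a, ¬ G.Adj s w) ∨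
    ∃ b ∈ C, G.Adj a b ∧ ∀ u ∈ C ∪ P, G.Adj a u → u = b ∨ G.Adj u b := by
  have hlt : ∀ b ∈ C, b ≠ a → r a < r b := fun b hb hne =>
    lt_of_le_of_ne (hmin b hb) fun h => hne (hr.1 (Set.mem_univ _) (Set.mem_univ _) h).symm
  have hpe : ∀ v x y, r v < r x → r v < r y → G.Adj v x → G.Adj v y → x ≠ y → G.Adj x y :=
    fun v x y => hr.2 v trivial x trivial y trivial
  by_cases h1 : ∀ w ∈ C, ¬ G.Adj a w
  · exact Or.inl h1
  by_cases h2 : 2 ≤ (P.filter (G.Adj a)).card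
  · exact Or.inr (Or.inl h2)
  by_cases h3 : ∃ s ∈ P, G.Adj a s ∧ ∀ w ∈ C.erase a, ¬ G.Adj s w
  · exact Or.inr (Or.inr (Or.inl h3))
  refine Or.inr (Or.inr (Or.inr ?_))
  push Not at h1 h2 h3
  have huniq : ∀ s ∈ P, G.Adj a s → ∀ u ∈ P, G.Adj a u → u = s := fun s hs has u hu hau =>
    Finset.card_le_one.mp (Nat.lt_succ_iff.mp h2) u (Finset.mem_filter.mpr ⟨hu, hau⟩) s
      (Finset.mem_filter.mpr ⟨hs, has⟩)
  -- Only vertices of `P` can precede `a` in the order. If the unique `P`-neighbor `s` of `a` does,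
  -- elimination at `s` makes `a` adjacent to another neighbor `b ∈ C` of `s`, and elimination at
  -- `a` makes `b` adjacent to the remaining neighbors of `a` in `C`. Otherwise all neighbors of `a`
  -- in `C ∪ P` come later and form a clique, so any `b ∈ C` among them works.
  by_cases h4 : ∃ s ∈ P, G.Adj a s ∧ r s < r a
  · obtain ⟨s, hs, has, hrs⟩ := h4
    obtain ⟨b, hb, hsb⟩ := h3 s hs has
    rw [Finset.mem_erase] at hb
    have hab : G.Adj a b :=
      hpe s a b hrs (hrs.trans (hlt b hb.2 hb.1)) has.symm hsb hb.1.symm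
    refine ⟨b, hb.2, hab, fun u hu hau => ?_⟩
    rcases Finset.mem_union.mp hu with hu | hu
    · exact or_iff_not_imp_left.mpr
        (hpe a u b (hlt u hu hau.ne') (hlt b hb.2 hb.1) hau hab)
    · exact Or.inr (huniq s hs has u hu hau ▸ hsb)
  · push Not at h4
    obtain ⟨b, hb, hab⟩ := h1
    refine ⟨b, hb, hab, fun u hu hau => ?_⟩
    have hau' : r a < r u := by
      rcases Finset.mem_union.mp hu with hu | hu
      · exact hlt u hu hau.ne'
      · exact lt_of_le_of_ne (h4 u hu hau)
          fun h => hau.ne (hr.1 (Set.mem_univ _) (Set.mem_univ _) h)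
    exact or_iff_not_imp_left.mpr (hpe a u b hau' (hlt b hb hab.ne') hau hab)

-- Branching on whether the first vertex `a` of `C` is chosen, with weight 1.89 per vertex of `C`
-- and 5/4 per vertex of `P`. Rejecting `a` may cost a factor 5/4; this is made up for by vertices
-- of `P` or `C` that become useless.
open Classical in
theorem IsPerfectElimination.card_privateFamily_le {r : V → ℕ}
    (hr : IsPerfectElimination G Set.univ r) (c : ℕ) :
    ∀ (C P : Finset V) (p : ℕ), C.card ≤ c → P.card ≤ p →
      ((privateFamily G C P).card : ℝ) ≤ (189 / 100) ^ c * (5 / 4) ^ p := by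
  have hβ : ∀ p : ℕ, (0 : ℝ) < (5 / 4) ^ p := fun p => by positivity
  have hα : ∀ c : ℕ, (0 : ℝ) < (189 / 100) ^ c := fun c => by positivity
  induction c using Nat.strong_induction_on with
  | _ c ih =>
  intro C P p hC hP
  rcases C.eq_empty_or_nonempty with rfl | hne
  · have : (privateFamily G ∅ P).card ≤ 1 := by
      refine (Finset.card_le_card (Finset.filter_subset _ _)).trans ?_
      simp
    calc ((privateFamily G ∅ P).card : ℝ) ≤ 1 := by exact_mod_cast this
      _ = 1 * 1 := by norm_num
      _ ≤ _ := mul_le_mul (one_le_pow₀ (by norm_num)) (one_le_pow₀ (by norm_num))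
        (by norm_num) (hα c).le
  obtain ⟨a, ha, hmin⟩ := C.exists_min_image r hne
  have hcard : 0 < C.card := Finset.card_pos.mpr hne
  obtain ⟨c, rfl⟩ : ∃ c', c = c' + 1 := ⟨c - 1, by omega⟩
  have hCe : (C.erase a).card ≤ c := by rw [Finset.card_erase_of_mem ha]; omega
  have hPi : (insert a P).card ≤ p + 1 := (Finset.card_insert_le a P).trans (by omega)
  have hPf : (P.filter fun s => ¬ G.Adj a s).card ≤ p :=
    (Finset.card_filter_le _ _).trans hP
  have hPD : (P.filter (G.Adj a)).card + (P.filter fun s => ¬ G.Adj a s).card = P.card :=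
    Finset.card_filter_add_card_filter_not _
  rcases hr.first_vertex_cases (P := P) hmin with h | h | ⟨s, hs, has, h⟩ | ⟨b, hb, hab, h⟩
  -- A rejected `a` without neighbors in `C` is useless in `P` too. Choosing `a` needs a neighbor in
  -- `P`, which is then used up: `1 + 4/5 ≤ 1.89`.
  · have hout : ∀ A ∈ privateFamily G C P, a ∉ A →
        A ∈ privateFamily G (C.erase a) ((insert a P).erase a) := fun A hA haA =>
      mem_privateFamily_erase_right (mem_privateFamily_erase_insert hA haA)
        (fun w hw => h w (Finset.mem_of_mem_erase hw))
    have hP' : ((insert a P).erase a).card ≤ p := by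
      rw [Finset.card_erase_of_mem (Finset.mem_insert_self _ _)]; omega
    have e1 := ih c (by omega) _ _ p hCe hP'
    rcases Nat.eq_zero_or_pos (P.filter (G.Adj a)).card with h0 | h0
    · have : (privateFamily G C P).card ≤
          (privateFamily G (C.erase a) ((insert a P).erase a)).card := by
        refine Finset.card_le_card fun A hA => hout A hA fun haA => ?_
        obtain ⟨u, hu, -, hu'⟩ := (mem_privateFamily.mp hA).2 a haA
        have hau := ((hu' a haA).mpr rfl).symm
        rcases Finset.mem_union.mp hu with hu | hu
        · exact h u hu hau
        · rw [Finset.card_eq_zero] at h0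
          exact Finset.notMem_empty u (h0 ▸ Finset.mem_filter.mpr ⟨hu, hau⟩)
      have this' : ((privateFamily G C P).card : ℝ) ≤
          (privateFamily G (C.erase a) ((insert a P).erase a)).card := by exact_mod_cast this
      rw [pow_succ]
      nlinarith [mul_pos (hα c) (hβ p)]
    · obtain ⟨p, rfl⟩ : ∃ p', p = p' + 1 := ⟨p - 1, by omega⟩
      have e2 := ih c (by omega) (C.erase a \ ∅) (P.filter fun s => ¬ G.Adj a s) p
        (by simpa using hCe) (by omega)
      have e3 := card_privateFamily_le_add (G := G) (C := C) (P := P) (a := a) hout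
          fun A hA haA => erase_mem_privateFamily (E := ∅) hA haA (by simp)
      rw [pow_succ] at e1
      rw [pow_succ, pow_succ]
      nlinarith [mul_pos (hα c) (hβ p)]
  -- Choosing `a` removes two vertices of `P`. This is the tight case: `5/4 + (4/5)^2 = 1.89`
  -- exactly.
  · obtain ⟨p, rfl⟩ : ∃ p', p = p' + 2 := ⟨p - 2, by omega⟩
    have e1 := ih c (by omega) _ _ _ hCe hPi
    have e2 := ih c (by omega) (C.erase a \ ∅) (P.filter fun s => ¬ G.Adj a s) p
      (by simpa using hCe) (by omega)
    have e3 := card_privateFamily_le_add (G := G) (C := C) (P := P) (a := a)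
      (fun A hA haA => mem_privateFamily_erase_insert hA haA)
        fun A hA haA => erase_mem_privateFamily (E := ∅) hA haA (by simp)
    rw [pow_add] at e1 ⊢
    rw [pow_add _ p 2] at *
    nlinarith [mul_pos (hα c) (hβ p)]
  -- Rejecting `a` lets it replace `s`, which has no other neighbor in `C`; choosing `a` removes
  -- `s`: `1 + 4/5 ≤ 1.89`.
  · obtain ⟨p, rfl⟩ : ∃ p', p = p' + 1 :=
      ⟨p - 1, by have := Finset.card_pos.mpr ⟨s, hs⟩; omega⟩
    have hD : 0 < (P.filter (G.Adj a)).card :=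
      Finset.card_pos.mpr ⟨s, Finset.mem_filter.mpr ⟨hs, has⟩⟩
    have e1 := ih c (by omega) (C.erase a) ((insert a P).erase s) (p + 1) hCe (by
      rw [Finset.card_erase_of_mem (Finset.mem_insert_of_mem hs)]; omega)
    have e2 := ih c (by omega) (C.erase a \ ∅) (P.filter fun s => ¬ G.Adj a s) p
      (by simpa using hCe) (by omega)
    have e3 := card_privateFamily_le_add (G := G) (C := C) (P := P) (a := a)
        (fun A hA haA => mem_privateFamily_erase_right (mem_privateFamily_erase_insert hA haA) h)
        fun A hA haA => erase_mem_privateFamily (E := ∅) hA haA (by simp)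
    rw [pow_succ] at e1
    rw [pow_succ, pow_succ]
    nlinarith [mul_pos (hα c) (hβ p)]
  -- Choosing `a` excludes `b`, so two candidates are decided: `5/4 * 1.89 + 1 ≤ 1.89^2`.
  · have hb' : b ∈ C.erase a := Finset.mem_erase.mpr ⟨hab.ne', hb⟩
    obtain ⟨c, rfl⟩ : ∃ c', c = c' + 1 :=
      ⟨c - 1, by have := Finset.card_pos.mpr ⟨b, hb'⟩; omega⟩
    have e1 := ih (c + 1) (by omega) _ _ _ hCe hPi
    have e2 := ih c (by omega) (C.erase a \ {b}) (P.filter fun s => ¬ G.Adj a s) p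
      (by rw [Finset.sdiff_singleton_eq_erase, Finset.card_erase_of_mem hb']; omega) hPf
    have e3 := card_privateFamily_le_add (G := G) (C := C) (P := P) (a := a)
      (fun A hA haA => mem_privateFamily_erase_insert hA haA)
        fun A hA haA => erase_mem_privateFamily (E := {b}) hA haA fun e he => by
          obtain rfl := Finset.mem_singleton.mp he
          exact ⟨notMem_of_dominates_neighbors hA haA hab h, hab⟩
    rw [pow_succ, pow_succ] at e1
    rw [pow_succ, pow_succ]
    nlinarith [mul_pos (hα c) (hβ p)]

/-- In a chordal graph on `n` vertices there are at most `1.89 ^ n` sets of vertices all of whose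
elements have private neighbors. -/
theorem IsChordal.card_hasPrivateNeighbors_le [Fintype V] (hG : IsChordal G)
    (S : Finset (Finset V)) (hS : ∀ A ∈ S, HasPrivateNeighbors G Finset.univ A) :
    (S.card : ℝ) ≤ (189 / 100) ^ Fintype.card V := by
  obtain ⟨r, hr⟩ := hG.exists_isPerfectElimination Set.univ
  have h := hr.card_privateFamily_le _ Finset.univ ∅ 0 le_rfl le_rfl
  rw [pow_zero, mul_one] at h
  refine le_trans ?_ h
  exact_mod_cast Finset.card_le_card fun A hA =>
    mem_privateFamily.mpr ⟨Finset.subset_univ _, by simpa using hS A hA⟩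

end Counting

/-! ### Minimal Roman dominating functions and private neighbors -/

section MinimalRDF

variable {V : Type*} {G : SimpleGraph V}

theorem HasPrivateNeighbors.mono {U A B : Finset V} (hA : HasPrivateNeighbors G U A)
    (hBA : B ⊆ A) : HasPrivateNeighbors G U B := by
  intro a ha
  obtain ⟨u, hu, hu', h⟩ := hA a (hBA ha)
  exact ⟨u, hu, fun h' => hu' (hBA h'), fun w hw => h w (hBA hw)⟩

open Classical in
/-- The function with value `2` on `A`, value `0` on the vertices outside `A` with a neighbor
in `A`, and value `1` elsewhere. -/
noncomputable def rdfOf (G : SimpleGraph V) (A : Finset V) (v : V) : Fin 3 :=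
  if v ∈ A then 2 else if ∃ u ∈ A, G.Adj v u then 0 else 1

theorem rdfOf_eq_two {A : Finset V} {v : V} : rdfOf G A v = 2 ↔ v ∈ A := by
  unfold rdfOf; split_ifs <;> simp_all

theorem rdfOf_eq_zero {A : Finset V} {v : V} :
    rdfOf G A v = 0 ↔ v ∉ A ∧ ∃ u ∈ A, G.Adj v u := by
  unfold rdfOf; split_ifs <;> simp_all

theorem rdfOf_injective : Function.Injective (rdfOf G) := by
  intro A B h
  ext v
  rw [← rdfOf_eq_two (G := G), h, rdfOf_eq_two]

/-- An rdf `g` below `rdfOf G A` takes the value 2 only inside `A`. A private neighbor of `v ∈ A`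
has value 0 under `g` and can be dominated only by `v`, which forces `g v = 2`. A vertex of value 1
has no neighbor in `A` and cannot drop to 0. -/
theorem isMinimalRDF_rdfOf [Fintype V] {A : Finset V}
    (hA : HasPrivateNeighbors G Finset.univ A) : IsMinimalRDF G (rdfOf G A) := by
  refine ⟨fun v hv => ?_, fun g hg hgf v => ?_⟩
  · obtain ⟨-, u, hu, hvu⟩ := rdfOf_eq_zero.mp hv
    exact ⟨u, hvu, rdfOf_eq_two.mpr hu⟩
  · have hdom : ∀ u, g u = 0 → ∃ w ∈ A, G.Adj u w ∧ g w = 2 := by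
      intro u hu
      obtain ⟨w, huw, hw⟩ := hg u hu
      refine ⟨w, (rdfOf_eq_two (G := G)).mp (le_antisymm (Fin.le_last _) ?_), huw, hw⟩
      exact hw ▸ hgf w
    by_cases hv : v ∈ A
    · obtain ⟨u, -, hu, h⟩ := hA v hv
      have hu0 : rdfOf G A u = 0 := rdfOf_eq_zero.mpr ⟨hu, v, hv, (h v hv).mpr rfl⟩
      obtain ⟨w, hw, huw, hw2⟩ := hdom u (le_antisymm (hu0 ▸ hgf u) (Fin.zero_le _))
      rw [(h w hw).mp huw] at hw2
      exact hw2 ▸ Fin.le_last _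
    · by_cases h0 : ∃ u ∈ A, G.Adj v u
      · rw [rdfOf_eq_zero.mpr ⟨hv, h0⟩]; exact Fin.zero_le _
      · have h1 : rdfOf G A v = 1 := by simp only [rdfOf, if_neg hv, if_neg h0]
        rw [h1]
        refine Fin.one_le_of_ne_zero fun h => h0 ?_
        obtain ⟨w, hw, hvw, -⟩ := hdom v h
        exact ⟨w, hw, hvw⟩

-- Minimality is tested on two changes of `f`. Lowering a 2 to 1 must leave some vertex undominated,
-- and that vertex is a private neighbor; lowering a 1 to 0 must fail, so a vertex of value 1 has no
-- neighbor of value 2.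
open Classical in
theorem IsMinimalRDF.exists_rdfOf [Fintype V] {f : V → Fin 3} (hf : IsMinimalRDF G f) :
    ∃ A, HasPrivateNeighbors G Finset.univ A ∧ rdfOf G A = f := by
  have h3 : ∀ k : Fin 3, k ≠ 0 → k ≠ 2 → k = 1 := by decide
  refine ⟨Finset.univ.filter fun v => f v = 2, ?_, ?_⟩
  · intro a ha
    have ha2 : f a = 2 := by simpa using ha
    have hnot : ¬ IsRDF G (Function.update f a 1) := fun h => by
      have := hf.2 h (fun v => by
        by_cases hv : v = a
        · subst hv; simp [ha2]
        · simp [hv]) a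
      simp [ha2] at this
    simp only [IsRDF, not_forall, not_exists, not_and] at hnot
    obtain ⟨u, hu0, hu⟩ := hnot
    have hua : u ≠ a := by rintro rfl; simp at hu0
    rw [Function.update_of_ne hua] at hu0
    have huniq : ∀ w, G.Adj u w → f w = 2 → w = a := fun w huw hw => by
      by_contra hwa
      exact hu w huw (by rw [Function.update_of_ne hwa, hw])
    obtain ⟨w, huw, hw⟩ := hf.1 u hu0
    refine ⟨u, Finset.mem_univ _, by simp [hu0], fun x hx => ⟨fun h => ?_, ?_⟩⟩
    · exact huniq x h (by simpa using hx)
    · rintro rfl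
      exact huniq w huw hw ▸ huw
  · funext v
    by_cases h2 : f v = 2
    · rw [h2]; exact rdfOf_eq_two.mpr (by simpa using h2)
    by_cases h0 : f v = 0
    · obtain ⟨w, hvw, hw⟩ := hf.1 v h0
      rw [h0]; exact rdfOf_eq_zero.mpr ⟨by simp [h0], w, by simpa using hw, hvw⟩
    · have h1 : f v = 1 := h3 _ h0 h2
      have hno : ¬ ∃ u ∈ Finset.univ.filter (fun v => f v = 2), G.Adj v u := by
        rintro ⟨w, hw, hvw⟩
        have hw2 : f w = 2 := by simpa using hw
        have hrdf : IsRDF G (Function.update f v 0) := by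
          intro u hu
          by_cases huv : u = v
          · subst huv
            exact ⟨w, hvw, by rw [Function.update_of_ne hvw.ne', hw2]⟩
          · rw [Function.update_of_ne huv] at hu
            obtain ⟨x, hux, hx⟩ := hf.1 u hu
            have hxv : x ≠ v := by rintro rfl; rw [h1] at hx; exact absurd hx (by decide)
            exact ⟨x, hux, by rw [Function.update_of_ne hxv, hx]⟩
        have := hf.2 hrdf (fun u => by
          by_cases huv : u = v
          · subst huv; simp
          · simp [huv]) v
        simp [h1] at this
      rw [rdfOf, if_neg (by simp [h2]), if_neg hno, h1]

end MinimalRDF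

/-! ### A program logic for output, delays and space -/

theorem outputs_append (t t' : List Event) : outputs (t ++ t') = outputs t ++ outputs t' := by
  induction t with
  | nil => rfl
  | cons e t ih => cases e <;> simp [outputs, ih]

theorem length_delays (t : List Event) (k : ℕ) : (delays k t).length = (outputs t).length + 1 := by
  induction t generalizing k with
  | nil => rfl
  | cons e t ih => cases e <;> simp [delays, outputs, ih]

/-- The last entry is the time still running since the last item, hence the initial count for the
rest of the run. -/
theorem delays_append {t t' : List Event} {k d : ℕ} {l : List ℕ} (h : delays k t = l ++ [d]) :
    delays k (t ++ t') = l ++ delays d t' := by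
  induction t generalizing k l with
  | nil =>
    have : [k] = l ++ [d] := h
    rcases l with _ | ⟨x, l⟩
    · simp_all
    · simp at this
  | cons e t ih =>
    cases e with
    | tick s => exact ih h
    | item w =>
      have h' : k :: delays 0 t = l ++ [d] := h
      rcases l with _ | ⟨x, l⟩
      · have := length_delays t 0
        simp_all
      · simp only [List.cons_append, List.cons.injEq] at h'
        simp [delays, h'.1, ih h'.2]

theorem delays_replicate_tick (s : State) (m k : ℕ) (t : List Event) :
    delays k (List.replicate m (.tick s) ++ t) = delays (k + m) t := by
  induction m generalizing k with
  | zero => rfl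
  | succ m ih => simp [List.replicate_succ, delays, ih, add_assoc, add_comm 1 m]

theorem outputs_replicate_tick (s : State) (m : ℕ) (t : List Event) :
    outputs (List.replicate m (.tick s) ++ t) = outputs t := by
  induction m with
  | zero => rfl
  | succ m ih => simp [List.replicate_succ, outputs, ih]

theorem sum_delays (t : List Event) (k : ℕ) : (delays k t).sum = time t + k := by
  induction t generalizing k with
  | nil => simp [delays, time]
  | cons e t ih => cases e <;> simp [delays, time, ih] <;> omega

/-- The running time is at most the number of delays times the maximal delay. -/
theorem time_le_of_delays_le {t : List Event} {D : ℕ} (h : ∀ d ∈ delays 0 t, d ≤ D) :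
    time t ≤ ((outputs t).length + 1) * D := by
  have := List.sum_le_card_nsmul _ _ h
  rwa [sum_delays, length_delays, smul_eq_mul] at this

/-- All registers hold at most `M`, and so do all array cells, the nonzero ones having addresses
below `M`. -/
def State.BoundedBy (s : State) (M : ℕ) : Prop :=
  (∀ x, s.var x ≤ M) ∧ ∀ a i, s.arr a i ≠ 0 → i < M ∧ s.arr a i ≤ M

/-- Bounding the values themselves by `M` is far stronger than bounding their bit lengths, and
easier to carry through a run. -/
theorem State.BoundedBy.fitsIn {s : State} {M : ℕ} (h : s.BoundedBy M) : s.FitsIn M := by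
  have hsize : ∀ k ≤ M, k.size ≤ M := fun k hk =>
    Nat.size_le.mpr (hk.trans_lt Nat.lt_two_pow_self)
  exact ⟨fun x => hsize _ (h.1 x), fun a i hi => ⟨(h.2 a i hi).1, hsize _ (h.2 a i hi).2⟩⟩

theorem State.BoundedBy.setVar {s : State} {M x k : ℕ} (h : s.BoundedBy M) (hk : k ≤ M) :
    (s.setVar x k).BoundedBy M := by
  refine ⟨fun y => ?_, h.2⟩
  by_cases hy : y = x
  · subst hy; simpa [State.setVar] using hk
  · simpa [State.setVar, hy] using h.1 y

theorem State.BoundedBy.setArr {s : State} {M a i k : ℕ} (h : s.BoundedBy M) (hi : i < M)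
    (hk : k ≤ M) : (s.setArr a i k).BoundedBy M := by
  refine ⟨h.1, fun b j hj => ?_⟩
  by_cases hb : b = a
  · subst hb
    by_cases hij : j = i
    · subst hij; exact ⟨hi, by simpa [State.setArr] using hk⟩
    · simp only [State.setArr, Function.update_self, Function.update_of_ne hij] at hj ⊢
      exact h.2 b j hj
  · simp only [State.setArr, Function.update_of_ne hb] at hj ⊢
    exact h.2 b j hj

/-- Started in memory `s`, with `d` time steps since the last printed item, the program `p` halts
after printing `L`, in memory `s'` with `d'` time steps since the last printed item, where
`Q s' d'` holds; until then, the memory is bounded by `M` and the delays are at most `D`. -/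
def Yields (M D : ℕ) (p : Program) (s : State) (d : ℕ) (L : List (List ℕ))
    (Q : State → ℕ → Prop) : Prop :=
  s.BoundedBy M → ∃ (t : List Event) (s' : State), Exec p s t s' ∧ outputs t = L ∧
    (∀ s'', Event.tick s'' ∈ t → s''.BoundedBy M) ∧ s'.BoundedBy M ∧
    ∃ (l : List ℕ) (d' : ℕ), delays d t = l ++ [d'] ∧ (∀ x ∈ l, x ≤ D) ∧ Q s' d'

namespace Yields

variable {M D : ℕ} {p q : Program} {s : State} {d : ℕ} {L L' : List (List ℕ)}
  {Q Q' : State → ℕ → Prop}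

theorem of_boundedBy (h : s.BoundedBy M → Yields M D p s d L Q) : Yields M D p s d L Q :=
  fun hs => h hs hs

theorem mono (h : Yields M D p s d L Q) (hQ : ∀ s' d', s'.BoundedBy M → Q s' d' → Q' s' d') :
    Yields M D p s d L Q' := by
  intro hs
  obtain ⟨t, s', h1, h2, h3, h4, l, d', h5, h6, h7⟩ := h hs
  exact ⟨t, s', h1, h2, h3, h4, l, d', h5, h6, hQ _ _ h4 h7⟩

theorem tick_cons {p : Program} {s s' : State} (hs' : s'.BoundedBy M)
    (h : Yields M D q s' (d + 1) L Q)
    (hx : ∀ t s'', Exec q s' t s'' → Exec p s (.tick s' :: t) s'') : Yields M D p s d L Q := by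
  intro _
  obtain ⟨t, s'', h1, h2, h3, h4, l, d', h5, h6, h7⟩ := h hs'
  refine ⟨.tick s' :: t, s'', hx _ _ h1, h2, ?_, h4, l, d', h5, h6, h7⟩
  intro r hr
  rcases List.mem_cons.mp hr with hr | hr
  · cases hr; exact hs'
  · exact h3 r hr

theorem of_exec_tick {p : Program} {s s' : State} (hs' : s.BoundedBy M → s'.BoundedBy M)
    (hx : Exec p s [.tick s'] s') (hQ : Q s' (d + 1)) : Yields M D p s d [] Q := by
  intro hs
  refine ⟨_, s', hx, rfl, ?_, hs' hs, [], d + 1, rfl, by simp, hQ⟩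
  intro r hr
  cases List.mem_singleton.mp hr
  exact hs' hs

theorem skip (hQ : Q s (d + 1)) : Yields M D .skip s d [] Q :=
  of_exec_tick id (.skip s) hQ

theorem assign {x : ℕ} {e : Expr} (he : e.eval s ≤ M) (hQ : Q (s.setVar x (e.eval s)) (d + 1)) :
    Yields M D (.assign x e) s d [] Q :=
  of_exec_tick (fun hs => hs.setVar he) (.assign s x e) hQ

theorem store {a : ℕ} {i e : Expr} (hi : i.eval s < M) (he : e.eval s ≤ M)
    (hQ : Q (s.setArr a (i.eval s) (e.eval s)) (d + 1)) :
    Yields M D (.store a i e) s d [] Q :=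
  of_exec_tick (fun hs => hs.setArr hi he) (.store s a i e) hQ

theorem output {a : ℕ} {e : Expr} (hd : d + e.eval s + 1 ≤ D) (hQ : Q s 0) :
    Yields M D (.output a e) s d [(List.range (e.eval s)).map (s.arr a)] Q := by
  intro hs
  refine ⟨_, s, .output s a e, by rw [outputs_replicate_tick]; rfl, ?_, hs,
    [d + (e.eval s + 1)], 0, by rw [delays_replicate_tick]; rfl, by simpa [← add_assoc] using hd, hQ⟩
  intro r hr
  rcases List.mem_append.mp hr with hr | hr
  · cases List.eq_of_mem_replicate hr; exact hs
  · simp at hr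

/-- The postcondition of the first program is the claim about the second, so proofs can follow the
program text. -/
theorem seq (h : Yields M D p s d L fun s' d' => Yields M D q s' d' L' Q) :
    Yields M D (.seq p q) s d (L ++ L') Q := by
  intro hs
  obtain ⟨t, s', h1, h2, h3, h4, l, d', h5, h6, h7⟩ := h hs
  obtain ⟨t', s'', k1, k2, k3, k4, l', d'', k5, k6, k7⟩ := h7 h4
  refine ⟨t ++ t', s'', h1.seq k1, by rw [outputs_append, h2, k2], ?_, k4, l ++ l', d'',
    by rw [delays_append h5, k5, List.append_assoc], ?_, k7⟩
  · intro r hr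
    exact (List.mem_append.mp hr).elim (h3 r) (k3 r)
  · intro x hx
    exact (List.mem_append.mp hx).elim (h6 x) (k6 x)

theorem cond {e : Expr} (h₁ : e.eval s ≠ 0 → Yields M D p s (d + 1) L Q)
    (h₂ : e.eval s = 0 → Yields M D q s (d + 1) L Q) : Yields M D (.cond e p q) s d L Q := by
  refine of_boundedBy fun hs => ?_
  by_cases he : e.eval s = 0
  · exact tick_cons hs (h₂ he) fun t s'' hx => .condFalse he hx
  · exact tick_cons hs (h₁ he) fun t s'' hx => .condTrue he hx

theorem loopDone {e : Expr} (he : e.eval s = 0) (hQ : Q s (d + 1)) :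
    Yields M D (.loop e p) s d [] Q :=
  of_exec_tick id (.loopDone he) hQ

theorem loopStep {e : Expr} (he : e.eval s ≠ 0)
    (h : Yields M D p s (d + 1) L fun s' d' => Yields M D (.loop e p) s' d' L' Q) :
    Yields M D (.loop e p) s d (L ++ L') Q := by
  refine of_boundedBy fun hs => tick_cons hs (seq h) fun t s'' hx => ?_
  cases hx with
  | seq h₁ h₂ => exact .loopStep he h₁ h₂

end Yields

/-- Run `p` with register `x` ranging over the numbers below the content of register `0`. -/
def Program.forAll (x : ℕ) (p : Program) : Program :=
  .seq (.assign x (.const 0))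
    (.loop (.sub (.var 0) (.var x)) (.seq p (.assign x (.add (.var x) (.const 1)))))

theorem Yields.forAll {M D n K x : ℕ} {p : Program} (I : ℕ → State → Prop) (hn : n ≤ M)
    (hI : ∀ j s, I j s → s.var 0 = n ∧ s.var x = j)
    (hp : ∀ j < n, ∀ s d, I j s → Yields M D p s d [] fun s' d' =>
      d' ≤ d + K ∧ s'.var x = j ∧ I (j + 1) (s'.setVar x (j + 1)))
    -- Each round costs `K` plus a test and an increment; the final `+ 2` is the initialization and
    -- the last test.
    {s : State} {d : ℕ} {Q : State → ℕ → Prop} (h0 : I 0 (s.setVar x 0))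
    (hQ : ∀ s' d', d' ≤ d + n * (K + 2) + 2 → I n s' → Q s' d') :
    Yields M D (p.forAll x) s d [] Q := by
  refine Yields.seq (L := []) (L' := []) (Yields.assign (Nat.zero_le _) ?_)
  have key : ∀ m j, j + m = n → ∀ s d, I j s →
      Yields M D (.loop (.sub (.var 0) (.var x)) (.seq p (.assign x (.add (.var x) (.const 1)))))
        s d [] fun s' d' => d' ≤ d + m * (K + 2) + 1 ∧ I n s' := by
    intro m
    induction m with
    | zero =>
      intro j hj s d hs
      obtain rfl : j = n := hj
      refine Yields.loopDone ?_ ⟨by omega, hs⟩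
      have := hI j s hs
      simp [Expr.eval, this.1, this.2]
    | succ m ih =>
      intro j hj s d hs
      have h := hI j s hs
      refine Yields.loopStep (L := []) (L' := []) ?_ (Yields.seq (L := []) (L' := [])
        ((hp j (by omega) s (d + 1) hs).mono fun s' d' _ h' => Yields.assign ?_ ?_))
      · simp only [Expr.eval, h.1, h.2]; omega
      · simp only [Expr.eval, h'.2.1]; omega
      · simp only [Expr.eval, h'.2.1]
        refine (ih (j + 1) (by omega) _ (d' + 1) h'.2.2).mono fun s'' d'' _ h'' => ⟨?_, h''.2⟩
        have h1 := h''.1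
        have h2 := h'.1
        rw [Nat.add_mul]
        omega
  exact (key n 0 (by omega) _ _ h0).mono fun s' d' _ h => hQ s' d' (by omega) h.2

/-! ### Testing for private neighbors -/

@[simp] theorem State.setVar_var (s : State) (x k y : ℕ) :
    (s.setVar x k).var y = if y = x then k else s.var y :=
  Function.update_apply ..

@[simp] theorem State.setVar_arr (s : State) (x k : ℕ) : (s.setVar x k).arr = s.arr := rfl

@[simp] theorem State.setArr_var (s : State) (a i k : ℕ) : (s.setArr a i k).var = s.var := rfl

@[simp] theorem State.setArr_arr (s : State) (a i k b j : ℕ) :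
    (s.setArr a i k).arr b j = if b = a ∧ j = i then k else s.arr b j := by
  by_cases hb : b = a
  · subst hb
    simp [State.setArr, Function.update_apply]
  · simp [State.setArr, hb]

section Check

variable {n : ℕ} {G : SimpleGraph (Fin n)} {A : Finset (Fin n)} {i j M D d : ℕ} {s s₀ : State}

open Classical in
/-- The memory holds the graph `G`, the position `i` and the set `A`. -/
structure Holds (G : SimpleGraph (Fin n)) (i : ℕ) (A : Finset (Fin n)) (s : State) : Prop where
  order : s.var 0 = n
  pos : s.var 1 = i
  adj : ∀ u v : Fin n, s.arr 0 (u.val * n + v.val) = if G.Adj u v then 1 else 0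
  bits : ∀ v : Fin n, s.arr 1 v.val = if v ∈ A then 1 else 0

theorem Holds.setVar (h : Holds G i A s) {x : ℕ} (k : ℕ) (hx : 2 ≤ x) :
    Holds G i A (s.setVar x k) where
  order := by rw [State.setVar_var, if_neg (by omega), h.order]
  pos := by rw [State.setVar_var, if_neg (by omega), h.pos]
  adj := h.adj
  bits := h.bits

theorem Holds.setArr (h : Holds G i A s) {a : ℕ} (l k : ℕ) (ha : 2 ≤ a) :
    Holds G i A (s.setArr a l k) where
  order := h.order
  pos := h.pos
  adj u v := by rw [State.setArr_arr, if_neg (by omega), h.adj]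
  bits v := by rw [State.setArr_arr, if_neg (by omega), h.bits]

open Classical in
/-- The neighbors of `u` in `A` that are smaller than `j`. -/
noncomputable def neighborsBelow (G : SimpleGraph (Fin n)) (A : Finset (Fin n)) (u : Fin n)
    (j : ℕ) : Finset (Fin n) :=
  Finset.univ.filter fun w => w.val < j ∧ w ∈ A ∧ G.Adj u w

theorem mem_neighborsBelow {u w : Fin n} :
    w ∈ neighborsBelow G A u j ↔ w.val < j ∧ w ∈ A ∧ G.Adj u w := by
  simp [neighborsBelow]

theorem neighborsBelow_succ_of_adj {u : Fin n} (hj : j < n) (hA : (⟨j, hj⟩ : Fin n) ∈ A)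
    (hu : G.Adj u ⟨j, hj⟩) :
    neighborsBelow G A u (j + 1) = insert ⟨j, hj⟩ (neighborsBelow G A u j) := by
  ext w
  simp only [Finset.mem_insert, mem_neighborsBelow]
  constructor
  · rintro ⟨h, h'⟩
    rcases (Nat.lt_succ_iff.mp h).lt_or_eq with h | h
    · exact Or.inr ⟨h, h'⟩
    · exact Or.inl (Fin.ext h)
  · rintro (rfl | ⟨h, h'⟩)
    · exact ⟨Nat.lt_succ_self _, hA, hu⟩
    · exact ⟨h.trans (Nat.lt_succ_self _), h'⟩

theorem neighborsBelow_succ_of_not {u : Fin n} (hj : j < n)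
    (h : ¬ ((⟨j, hj⟩ : Fin n) ∈ A ∧ G.Adj u ⟨j, hj⟩)) :
    neighborsBelow G A u (j + 1) = neighborsBelow G A u j := by
  ext w
  simp only [mem_neighborsBelow]
  refine ⟨fun ⟨h1, h2⟩ => ⟨lt_of_le_of_ne (Nat.lt_succ_iff.mp h1) fun h3 => h ?_, h2⟩,
    fun ⟨h1, h2⟩ => ⟨h1.trans (Nat.lt_succ_self _), h2⟩⟩
  subst h3
  exact h2

theorem neighborsBelow_eq_singleton_iff {u w : Fin n} (hw : w ∈ A) :
    neighborsBelow G A u n = {w} ↔ ∀ x ∈ A, G.Adj u x ↔ x = w := by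
  simp only [Finset.ext_iff, mem_neighborsBelow, Finset.mem_singleton]
  refine ⟨fun h x hx => ?_, fun h x => ?_⟩
  · rw [← h x]; simp [hx]
  · refine ⟨fun hx => (h x hx.2.1).mp hx.2.2, ?_⟩
    rintro rfl
    exact ⟨x.isLt, hw, (h x hw).mpr rfl⟩

/-- Count the neighbors in `A` of the vertex in register `2` into register `5`, and put the last
of them into register `7`. -/
def countNeighbors : Program :=
  .forAll 3 (.seq
    (.cond (.sub (.read 0 (.var 4)) (.sub (.const 1) (.read 1 (.var 3))))
      (.seq (.assign 5 (.add (.var 5) (.const 1))) (.assign 7 (.var 3)))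
      .skip)
    (.assign 4 (.add (.var 4) (.const 1))))

/-- The invariant of `countNeighbors`, started in memory `s₀`. -/
structure CountInv (G : SimpleGraph (Fin n)) (i : ℕ) (A : Finset (Fin n)) (u : Fin n)
    (s₀ : State) (j : ℕ) (s : State) : Prop where
  holds : Holds G i A s
  arr_two : s.arr 2 = s₀.arr 2
  arr_three : s.arr 3 = s₀.arr 3
  vertex : s.var 2 = u
  neighbor : s.var 3 = j
  pointer : s.var 4 = u * n + j
  count : s.var 5 = (neighborsBelow G A u j).card
  last : s.var 5 ≠ 0 → ∃ w ∈ neighborsBelow G A u j, s.var 7 = w.val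

theorem index_lt {u j : ℕ} (hu : u < n) (hj : j < n) : u * n + j + 1 ≤ n * n := by
  have : (u + 1) * n ≤ n * n := Nat.mul_le_mul_right n hu
  rw [Nat.add_mul] at this
  omega

/-- On values 0 and 1 the test `adj - (1 - bit)` is a conjunction. Register `4` walks along row `u`
of the matrix by increments, as the machine cannot multiply. -/
theorem CountInv.step {u : Fin n} (hM : n * n + n + 2 ≤ M) (hj : j < n)
    (h : CountInv G i A u s₀ j s) :
    Yields M D (.seq
      (.cond (.sub (.read 0 (.var 4)) (.sub (.const 1) (.read 1 (.var 3))))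
        (.seq (.assign 5 (.add (.var 5) (.const 1))) (.assign 7 (.var 3)))
        .skip)
      (.assign 4 (.add (.var 4) (.const 1)))) s d [] fun s' d' =>
      d' ≤ d + 4 ∧ s'.var 3 = j ∧ CountInv G i A u s₀ (j + 1) (s'.setVar 3 (j + 1)) := by
  classical
  have hidx := index_lt u.isLt hj
  have hadj : s.arr 0 (s.var 4) = if G.Adj u ⟨j, hj⟩ then 1 else 0 := by
    rw [h.pointer]; exact h.holds.adj u ⟨j, hj⟩
  have hbit : s.arr 1 (s.var 3) = if (⟨j, hj⟩ : Fin n) ∈ A then 1 else 0 := by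
    rw [h.neighbor]; exact h.holds.bits ⟨j, hj⟩
  refine Yields.seq (L := []) (L' := []) (Yields.cond (fun he => ?_) (fun he => ?_))
  · have hu : G.Adj u ⟨j, hj⟩ := by
      by_contra hc; simp [Expr.eval, hadj, hc] at he
    have hA : (⟨j, hj⟩ : Fin n) ∈ A := by
      by_contra hc; simp [Expr.eval, hadj, hbit, hc, hu] at he
    have hcard : (neighborsBelow G A u (j + 1)).card = s.var 5 + 1 := by
      rw [neighborsBelow_succ_of_adj hj hA hu, Finset.card_insert_of_notMem, h.count]
      simp [mem_neighborsBelow]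
    have hle := (Finset.card_le_univ (neighborsBelow G A u (j + 1))).trans_eq (Fintype.card_fin n)
    refine Yields.seq (L := []) (L' := []) (Yields.assign ?_ (Yields.assign ?_ (Yields.assign ?_ ?_)))
    · simp only [Expr.eval]; omega
    · simp [Expr.eval, h.neighbor]; omega
    · simp [Expr.eval, h.pointer]; omega
    · refine ⟨by omega, by simp [h.neighbor], ?_⟩
      constructor
      · exact (((h.holds.setVar _ (by omega)).setVar _ (by omega)).setVar _ (by omega)).setVar _
          (by omega)
      · exact h.arr_two
      · exact h.arr_three
      · simp [h.vertex]
      · simp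
      · simp [Expr.eval, h.pointer]; omega
      · simp [Expr.eval, hcard]
      · intro _
        exact ⟨⟨j, hj⟩, mem_neighborsBelow.mpr ⟨Nat.lt_succ_self _, hA, hu⟩,
          by simp [Expr.eval, h.neighbor]⟩
  · have hno : ¬ ((⟨j, hj⟩ : Fin n) ∈ A ∧ G.Adj u ⟨j, hj⟩) := by
      rintro ⟨h1, h2⟩; simp [Expr.eval, hadj, hbit, h1, h2] at he
    refine Yields.skip (Yields.assign ?_ ?_)
    · simp [Expr.eval, h.pointer]; omega
    · refine ⟨by omega, by simp [h.neighbor], ?_⟩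
      constructor
      · exact (h.holds.setVar _ (by omega)).setVar _ (by omega)
      · exact h.arr_two
      · exact h.arr_three
      · simp [h.vertex]
      · simp
      · simp [Expr.eval, h.pointer]; omega
      · simp [h.count, neighborsBelow_succ_of_not hj hno]
      · simpa [neighborsBelow_succ_of_not hj hno] using h.last

theorem yields_countNeighbors {u : Fin n} (hM : n * n + n + 2 ≤ M) (h : Holds G i A s)
    (h2 : s.var 2 = u) (h4 : s.var 4 = u * n) (h5 : s.var 5 = 0) :
    Yields M D countNeighbors s d [] fun s' d' =>
      d' ≤ d + n * 6 + 2 ∧ CountInv G i A u s n s' := by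
  refine Yields.forAll (K := 4) (CountInv G i A u s) (by omega)
    (fun j s h => ⟨h.holds.order, h.neighbor⟩) (fun j hj s d hs => hs.step hM hj) ?_
    (fun s' d' hd hs => ⟨hd, hs⟩)
  constructor
  · exact h.setVar _ (by omega)
  · rfl
  · rfl
  · simp [h2]
  · simp
  · simp [h4]
  · simp [h5, neighborsBelow]
  · simp [h5]

/-- Compute the value of the vertex in register `2`, and mark the vertex it is a private neighbor
of. -/
def processVertex : Program :=
  .seq (.assign 5 (.const 0)) (.seq countNeighbors
    (.cond (.read 1 (.var 2))
      (.store 2 (.var 2) (.const 2))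
      (.cond (.var 5)
        (.seq (.store 2 (.var 2) (.const 0))
          (.cond (.sub (.var 5) (.const 1)) .skip (.store 3 (.var 7) (.const 1))))
        (.store 2 (.var 2) (.const 1)))))

/-- The vertex `w` is not in `A` or has a private neighbor below `j`. -/
def Marked (G : SimpleGraph (Fin n)) (A : Finset (Fin n)) (j : ℕ) (w : Fin n) : Prop :=
  w ∉ A ∨ ∃ u : Fin n, u.val < j ∧ u ∉ A ∧ ∀ x ∈ A, G.Adj u x ↔ x = w

theorem marked_succ {u w : Fin n} :
    Marked G A (u + 1) w ↔ Marked G A u w ∨ (u ∉ A ∧ neighborsBelow G A u n = {w}) := by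
  by_cases hw : w ∈ A
  · rw [neighborsBelow_eq_singleton_iff hw]
    simp only [Marked, hw, not_true, false_or]
    constructor
    · rintro ⟨v, hv, h⟩
      rcases (Nat.lt_succ_iff.mp hv).lt_or_eq with hv | hv
      · exact Or.inl ⟨v, hv, h⟩
      · exact Or.inr (Fin.ext hv ▸ h)
    · rintro (⟨v, hv, h⟩ | h)
      · exact ⟨v, hv.trans (Nat.lt_succ_self _), h⟩
      · exact ⟨u, Nat.lt_succ_self _, h⟩
  · simp [Marked, hw]

theorem forall_marked_iff : (∀ w, Marked G A n w) ↔ HasPrivateNeighbors G Finset.univ A := by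
  refine forall_congr' fun w => ?_
  simp [Marked, imp_iff_not_or]

/-- The invariant of the loop over `processVertex`. -/
structure MarkInv (G : SimpleGraph (Fin n)) (i : ℕ) (A : Finset (Fin n)) (j : ℕ) (s : State) :
    Prop where
  holds : Holds G i A s
  vertex : s.var 2 = j
  pointer : s.var 4 = j * n
  value : ∀ w : Fin n, w.val < j → s.arr 2 w.val = (rdfOf G A w).val
  mark : ∀ w : Fin n, s.arr 3 w.val ≠ 0 ↔ Marked G A j w

theorem MarkInv.step (hM : n * n + n + 2 ≤ M) (hj : j < n) (h : MarkInv G i A j s) :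
    Yields M D processVertex s d [] fun s' d' =>
      d' ≤ d + (n * 6 + 8) ∧ s'.var 2 = j ∧ MarkInv G i A (j + 1) (s'.setVar 2 (j + 1)) := by
  classical
  obtain ⟨u, rfl⟩ : ∃ u : Fin n, u.val = j := ⟨⟨j, hj⟩, rfl⟩
  refine Yields.seq (L := []) (L' := []) (Yields.assign (Nat.zero_le _) ?_)
  refine Yields.seq (L := []) (L' := []) ((yields_countNeighbors (u := u) hM
    (h.holds.setVar _ (by omega)) (by simp [h.vertex]) (by simp [h.pointer])
    (by simp [Expr.eval])).mono fun s' d' _ h' => ?_)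
  obtain ⟨hd, h'⟩ := h'
  have hv2 : ∀ w : Fin n, s'.arr 2 w.val = s.arr 2 w.val := fun w => by rw [h'.arr_two]; rfl
  have hv3 : ∀ w : Fin n, s'.arr 3 w.val = s.arr 3 w.val := fun w => by rw [h'.arr_three]; rfl
  have hbit := h'.holds.bits u
  have hptr : u.val * n + n = (u.val + 1) * n := by ring
  have hun : u.val < M := by omega
  -- All branches share this ending: the value of `u` is written, and `w` gets marked exactly if `u`
  -- is a private neighbor of it.
  have finish : ∀ s'' : State, Holds G i A s'' → s''.var 2 = u → s''.var 4 = u * n + n →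
      (∀ w : Fin n, s''.arr 2 w.val = if w = u then (rdfOf G A u).val else s'.arr 2 w.val) →
      (∀ w : Fin n, s''.arr 3 w.val ≠ 0 ↔ s'.arr 3 w.val ≠ 0 ∨
        (u ∉ A ∧ neighborsBelow G A u n = {w})) →
      s''.var 2 = u ∧ MarkInv G i A (u + 1) (s''.setVar 2 (u + 1)) := by
    intro s'' k1 k2 k3 k4 k5
    refine ⟨k2, k1.setVar _ (by omega), by simp, by simp [k3, hptr], ?_, ?_⟩
    · intro w hw
      rw [State.setVar_arr, k4]
      split_ifs with hwu
      · rw [hwu]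
      · rw [hv2, h.value w (lt_of_le_of_ne (Nat.lt_succ_iff.mp hw) fun h => hwu (Fin.ext h))]
    · intro w
      rw [State.setVar_arr, k5, marked_succ, ← h.mark, hv3]
  have hne : ∀ w : Fin n, (w.val = u.val) ↔ w = u := fun w => Fin.ext_iff.symm
  refine Yields.cond (fun he => ?_) (fun he => ?_)
  · have hu : u ∈ A := by
      by_contra hc; simp [Expr.eval, h'.vertex, hbit, hc] at he
    refine Yields.store (by simpa [Expr.eval, h'.vertex] using hun)
      (by simp only [Expr.eval]; omega) ⟨by omega, finish _ (h'.holds.setArr _ _ (by omega))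
        h'.vertex h'.pointer ?_ ?_⟩
    · intro w
      simp [Expr.eval, h'.vertex, hne, (rdfOf_eq_two (G := G)).mpr hu]
    · intro w
      simp [hu]
  · have hu : u ∉ A := by
      intro hc; simp [Expr.eval, h'.vertex, hbit, hc] at he
    refine Yields.cond (fun he5 => ?_) (fun he5 => ?_)
    · have h50 : s'.var 5 ≠ 0 := he5
      obtain ⟨x, hx, hx7⟩ := h'.last h50
      have hxA := mem_neighborsBelow.mp hx
      have hf : rdfOf G A u = 0 := rdfOf_eq_zero.mpr ⟨hu, x, hxA.2⟩
      refine Yields.seq (L := []) (L' := []) (Yields.store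
        (by simpa [Expr.eval, h'.vertex] using hun) (by simp only [Expr.eval]; omega) ?_)
      refine Yields.cond (fun he1 => ?_) (fun he1 => ?_)
      · refine Yields.skip ⟨by omega, finish _ (h'.holds.setArr _ _ (by omega))
          h'.vertex h'.pointer ?_ ?_⟩
        · intro w
          simp [Expr.eval, h'.vertex, hne, hf]
        · intro w
          have : neighborsBelow G A u n ≠ {w} := by
            intro hc
            simp [Expr.eval, h'.count, hc] at he1
          simp [this]
      -- With a count of exactly one, register `7` holds the only neighbor of `u` in `A`.
      · have h51 : s'.var 5 = 1 := by
          simp only [Expr.eval, State.setArr_var] at he1; omega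
        have hsing : neighborsBelow G A u n = {x} := by
          obtain ⟨y, hy⟩ := Finset.card_eq_one.mp (h'.count.symm.trans h51)
          rw [hy] at hx ⊢
          rw [Finset.mem_singleton.mp hx]
        refine Yields.store (by simp only [Expr.eval, State.setArr_var, hx7]; omega)
          (by simp only [Expr.eval]; omega) ⟨by omega, finish _
            ((h'.holds.setArr _ _ (by omega)).setArr _ _ (by omega)) h'.vertex h'.pointer ?_ ?_⟩
        · intro w
          simp [Expr.eval, h'.vertex, hne, hf]
        · intro w
          by_cases hwx : w = x
          · subst hwx; simp [Expr.eval, hx7, hu, hsing]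
          · have : w.val ≠ x.val := fun h => hwx (Fin.ext h)
            simp [Expr.eval, hx7, hu, hsing, this, Ne.symm hwx]
    · have hemp : neighborsBelow G A u n = ∅ :=
        Finset.card_eq_zero.mp (h'.count.symm.trans he5)
      have hf : rdfOf G A u = 1 := by
        rw [rdfOf, if_neg hu, if_neg]
        rintro ⟨x, hx, hux⟩
        exact Finset.notMem_empty x (hemp ▸ mem_neighborsBelow.mpr ⟨x.isLt, hx, hux⟩)
      refine Yields.store (by simpa [Expr.eval, h'.vertex] using hun)
        (by simp only [Expr.eval]; omega) ⟨by omega, finish _ (h'.holds.setArr _ _ (by omega))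
          h'.vertex h'.pointer ?_ ?_⟩
      · intro w
        simp [Expr.eval, h'.vertex, hne, hf]
      · intro w
        simp [hemp, (Finset.singleton_ne_empty w).symm]

/-- Compute the values of the function given by the set `A` into array `2`, and test whether all
elements of `A` have private neighbors; the answer is in register `6`. -/
def check : Program :=
  .seq (.forAll 2 (.store 3 (.var 2) (.sub (.const 1) (.read 1 (.var 2)))))
    (.seq (.assign 4 (.const 0))
      (.seq (.forAll 2 processVertex)
        (.seq (.assign 6 (.const 1))
          (.forAll 2 (.cond (.read 3 (.var 2)) .skip (.assign 6 (.const 0)))))))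

theorem yields_check (hM : n * n + n + 2 ≤ M) (h : Holds G i A s) :
    Yields M D check s d [] fun s' d' => d' ≤ d + 20 * (n + 1) ^ 2 ∧ Holds G i A s' ∧
      (∀ w : Fin n, s'.arr 2 w.val = (rdfOf G A w).val) ∧
      (s'.var 6 ≠ 0 ↔ HasPrivateNeighbors G Finset.univ A) := by
  classical
  -- Vertices outside `A` are marked from the start, so the test at the end only asks whether every
  -- vertex is marked.
  refine Yields.seq (L := []) (L' := []) (Yields.forAll (K := 1) (fun j s => Holds G i A s ∧
    s.var 2 = j ∧ ∀ w : Fin n, w.val < j → s.arr 3 w.val = if w ∈ A then 0 else 1) (by omega)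
    (fun j s h => ⟨h.1.order, h.2.1⟩) ?_ ⟨h.setVar _ (by omega), by simp, by simp⟩
    fun s₁ d₁ hd₁ h₁ => ?_)
  · rintro j hj s d ⟨h, h2, h3⟩
    have hbit := h.bits ⟨j, hj⟩
    refine Yields.store (by simp only [Expr.eval]; omega)
      (by simp only [Expr.eval]; omega) ⟨le_rfl, h2,
        (h.setArr _ _ (by omega)).setVar _ (by omega), by simp, fun w hw => ?_⟩
    rw [State.setVar_arr, State.setArr_arr]
    simp only [Expr.eval, h2, true_and]
    split_ifs with h4 h5 h5
    · rw [← h4, h.bits, if_pos h5]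
    · rw [← h4, h.bits, if_neg h5]
    · rw [h3 w (by omega), if_pos h5]
    · rw [h3 w (by omega), if_neg h5]
  obtain ⟨h₁, -, h₁'⟩ := h₁
  refine Yields.seq (L := []) (L' := []) (Yields.assign (Nat.zero_le _) ?_)
  refine Yields.seq (L := []) (L' := []) (Yields.forAll (MarkInv G i A) (by omega)
    (fun j s h => ⟨h.holds.order, h.vertex⟩) (fun j hj s d hs => hs.step hM hj) ?_
    fun s₂ d₂ hd₂ h₂ => ?_)
  · refine ⟨(h₁.setVar _ (by omega)).setVar _ (by omega), by simp, by simp [Expr.eval], by simp,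
      fun w => ?_⟩
    simp [h₁' w w.isLt, Marked]
  refine Yields.seq (L := []) (L' := []) (Yields.assign (by simp only [Expr.eval]; omega) ?_)
  refine Yields.forAll (K := 2) (fun j s => Holds G i A s ∧ s.var 2 = j ∧
    (∀ w : Fin n, s.arr 2 w.val = (rdfOf G A w).val) ∧
    (∀ w : Fin n, s.arr 3 w.val ≠ 0 ↔ Marked G A n w) ∧
    (s.var 6 ≠ 0 ↔ ∀ w : Fin n, w.val < j → Marked G A n w)) (by omega)
    (fun j s h => ⟨h.1.order, h.2.1⟩) ?_ ⟨(h₂.holds.setVar _ (by omega)).setVar _ (by omega),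
      by simp, fun w => h₂.value w w.isLt, h₂.mark, by simp [Expr.eval]⟩
      fun s₃ d₃ hd₃ h₃ => ?_
  · rintro j hj s d ⟨k1, k2, k3, k4, k5⟩
    have hall : (∀ w : Fin n, w.val < j + 1 → Marked G A n w) ↔
        (∀ w : Fin n, w.val < j → Marked G A n w) ∧ Marked G A n ⟨j, hj⟩ := by
      refine ⟨fun h => ⟨fun w hw => h w (by omega), h ⟨j, hj⟩ (Nat.lt_succ_self _)⟩,
        fun h w hw => ?_⟩
      rcases (Nat.lt_succ_iff.mp hw).lt_or_eq with hw | hw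
      · exact h.1 w hw
      · obtain rfl : w = ⟨j, hj⟩ := Fin.ext hw
        exact h.2
    have hj4 := k4 ⟨j, hj⟩
    refine Yields.cond (fun he => Yields.skip ⟨by omega, k2, k1.setVar _ (by omega), by simp,
      k3, k4, ?_⟩) (fun he => Yields.assign (Nat.zero_le _) ⟨by omega, by simp [k2],
        (k1.setVar _ (by omega)).setVar _ (by omega), by simp, k3, k4, ?_⟩)
    · have : Marked G A n ⟨j, hj⟩ := hj4.mp (by simpa [Expr.eval, k2] using he)
      rw [hall, ← k5]
      simp [this]
    · have : ¬ Marked G A n ⟨j, hj⟩ := fun hm => hj4.mpr hm (by simpa [Expr.eval, k2] using he)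
      rw [hall]
      simp [Expr.eval, this]
  · obtain ⟨k1, -, k3, -, k5⟩ := h₃
    refine ⟨?_, k1, k3, k5.trans ?_⟩
    · nlinarith
    · rw [← forall_marked_iff]
      exact forall_congr' fun w => by simp

end Check

/-! ### Enumeration by backtracking -/

section Enumeration

variable {n : ℕ} {G : SimpleGraph (Fin n)} {A B : Finset (Fin n)} {i M D d : ℕ} {s : State}

theorem Holds.setVar_one (h : Holds G i A s) (k : ℕ) : Holds G k A (s.setVar 1 k) where
  order := by simp [h.order]
  pos := by simp
  adj := h.adj
  bits := h.bits

theorem Holds.setArr_one_insert (h : Holds G i A s) (v : Fin n) :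
    Holds G i (insert v A) (s.setArr 1 v 1) where
  order := h.order
  pos := h.pos
  adj u w := by simp [h.adj]
  bits w := by
    have := h.bits w
    by_cases hw : w = v
    · subst hw; simp
    · have hw' : w.val ≠ v.val := fun h => hw (Fin.ext h)
      simp [hw, hw', this]

theorem Holds.setArr_one_erase (h : Holds G i A s) (v : Fin n) :
    Holds G i (A.erase v) (s.setArr 1 v 0) where
  order := h.order
  pos := h.pos
  adj u w := by simp [h.adj]
  bits w := by
    have := h.bits w
    by_cases hw : w = v
    · subst hw; simp
    · have hw' : w.val ≠ v.val := fun h => hw (Fin.ext h)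
      simp [hw, hw', this]

/-- Move to the previous position; remove it from the set if it is there, otherwise try to
add it, and start again from the last position if this succeeds. -/
def backtrackStep : Program :=
  .seq (.assign 1 (.sub (.var 1) (.const 1)))
    (.cond (.read 1 (.var 1))
      (.store 1 (.var 1) (.const 0))
      (.seq (.store 1 (.var 1) (.const 1)) (.seq check
        (.cond (.var 6)
          (.seq (.output 2 (.var 0)) (.assign 1 (.var 0)))
          (.store 1 (.var 1) (.const 0))))))

theorem output_eq_encode (h : Holds G i A s)
    (h2 : ∀ w : Fin n, s.arr 2 w.val = (rdfOf G A w).val) :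
    (List.range ((Expr.var 0).eval s)).map (s.arr 2) = encode (rdfOf G A) := by
  simp only [Expr.eval, h.order, encode]
  apply List.ext_getElem <;> simp
  intro j hj
  exact h2 ⟨j, hj⟩

/-- The number of time steps of one execution of `backtrackStep` and the loop test. -/
def stepCost (n : ℕ) : ℕ := 20 * (n + 1) ^ 2 + 6

theorem yields_backtrackStep_of_mem (hM : n * n + n + 2 ≤ M) {v : Fin n}
    (h : Holds G (v + 1) A s) (hv : v ∈ A) :
    Yields M D backtrackStep s d [] fun s' d' => Holds G v (A.erase v) s' ∧ d' ≤ d + 3 := by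
  have h' : Holds G v A (s.setVar 1 v) := h.setVar_one v
  refine Yields.seq (L := []) (L' := []) (Yields.assign (by simp [Expr.eval, h.pos]; omega) ?_)
  simp only [Expr.eval, h.pos, Nat.add_sub_cancel]
  refine Yields.cond (fun he => Yields.store ?_ (Nat.zero_le _) ⟨?_, by omega⟩) (fun he => ?_)
  · simp [Expr.eval]; omega
  · simpa [Expr.eval] using h'.setArr_one_erase v
  · have := h'.bits v
    simp_all [Expr.eval]

theorem yields_backtrackStep_of_notMem (hM : n * n + n + 2 ≤ M) {v : Fin n}
    (h : Holds G (v + 1) A s) (hv : v ∉ A)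
    (hA : ¬ HasPrivateNeighbors G Finset.univ (insert v A)) :
    Yields M D backtrackStep s d [] fun s' d' =>
      Holds G v A s' ∧ d' + 1 ≤ d + stepCost n := by
  have h' : Holds G v A (s.setVar 1 v) := h.setVar_one v
  have hbit := h'.bits v
  rw [if_neg hv] at hbit
  refine Yields.seq (L := []) (L' := []) (Yields.assign (by simp [Expr.eval, h.pos]; omega) ?_)
  simp only [Expr.eval, h.pos, Nat.add_sub_cancel]
  refine Yields.cond (fun he => ?_) (fun he => ?_)
  · simp_all [Expr.eval]
  refine Yields.seq (L := []) (L' := []) (Yields.store (by simp [Expr.eval]; omega)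
    (by simp only [Expr.eval]; omega) ?_)
  refine Yields.seq (L := []) (L' := []) ((yields_check (A := insert v A) hM
    (by simpa [Expr.eval] using h'.setArr_one_insert v)).mono fun s' d' _ hs' => ?_)
  obtain ⟨hd, k1, -, k3⟩ := hs'
  refine Yields.cond (fun he => absurd (k3.mp he) hA) (fun he => Yields.store ?_ (Nat.zero_le _)
    ⟨?_, by unfold stepCost; omega⟩)
  · simp only [Expr.eval, k1.pos]; omega
  · have := k1.setArr_one_erase v
    rw [Finset.erase_insert hv] at this
    simpa only [Expr.eval, k1.pos] using this

theorem yields_backtrackStep_of_success (hM : n * n + n + 2 ≤ M) {v : Fin n}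
    (h : Holds G (v + 1) A s) (hv : v ∉ A)
    (hA : HasPrivateNeighbors G Finset.univ (insert v A)) (hd : d + stepCost n + n ≤ D) :
    Yields M D backtrackStep s d [encode (rdfOf G (insert v A))] fun s' d' =>
      Holds G n (insert v A) s' ∧ d' = 1 := by
  have h' : Holds G v A (s.setVar 1 v) := h.setVar_one v
  have hbit := h'.bits v
  rw [if_neg hv] at hbit
  refine Yields.seq (L := []) (L' := [_]) (Yields.assign (by simp [Expr.eval, h.pos]; omega) ?_)
  simp only [Expr.eval, h.pos, Nat.add_sub_cancel]
  refine Yields.cond (fun he => ?_) (fun he => ?_)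
  · simp_all [Expr.eval]
  refine Yields.seq (L := []) (L' := [_]) (Yields.store (by simp [Expr.eval]; omega)
    (by simp only [Expr.eval]; omega) ?_)
  refine Yields.seq (L := []) (L' := [_]) ((yields_check (A := insert v A) hM
    (by simpa [Expr.eval] using h'.setArr_one_insert v)).mono fun s' d' _ hs' => ?_)
  obtain ⟨hd', k1, k2, k3⟩ := hs'
  refine Yields.cond (fun he => ?_) (fun he => absurd he (k3.mpr hA))
  refine Yields.seq (L := [_]) (L' := []) ?_
  rw [← output_eq_encode k1 k2]
  refine Yields.output ?_ (Yields.assign ?_ ⟨?_, rfl⟩)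
  · simp only [Expr.eval, k1.order]
    unfold stepCost at hd
    omega
  · simp only [Expr.eval, k1.order]; omega
  · simp only [Expr.eval, k1.order]
    exact k1.setVar_one n

/-- From the last position on, the loop prints all larger sets with the same elements below
position `k` as `B` and then arrives at position `k`. -/
theorem exists_list_yields_loop (hM : n * n + n + 2 ≤ M)
    (hD : 1 + stepCost n * (n + 1) + n ≤ D) (m k : ℕ) (hk : k + m = n) (B : Finset (Fin n))
    (hBk : ∀ v ∈ B, v.val < k) (hB : HasPrivateNeighbors G Finset.univ B) :
    ∃ L : List (Finset (Fin n)), L.Nodup ∧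
      (∀ A, A ∈ L ↔ HasPrivateNeighbors G Finset.univ A ∧ A ≠ B ∧
        ∀ v : Fin n, v.val < k → (v ∈ A ↔ v ∈ B)) ∧
      ∀ (L' : List (List ℕ)) (Q : State → ℕ → Prop),
        (∀ s d, Holds G k B s → d ≤ 1 + stepCost n * m →
          Yields M D (.loop (.var 1) backtrackStep) s d L' Q) →
        ∀ s d, Holds G n B s → d ≤ 1 →
          Yields M D (.loop (.var 1) backtrackStep) s d
            (L.map (fun A => encode (rdfOf G A)) ++ L') Q := by
  -- The continuation `L'`, `Q` is arbitrary so that recursive runs can be chained inside the single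
  -- loop. Printing resets the position to `n`, and every other step lowers it by one; hence at most
  -- `m` steps have passed without output on arrival at `k`.
  induction m generalizing k B with
  | zero =>
    obtain rfl : k = n := hk
    refine ⟨[], List.nodup_nil, fun A => ?_, fun L' Q h s d hs hd => h s d hs (by omega)⟩
    simp only [List.not_mem_nil, false_iff, not_and]
    exact fun _ hne h => hne (Finset.ext fun v => h v v.isLt)
  | succ m ih =>
    obtain ⟨v, rfl⟩ : ∃ v : Fin n, v.val = k := ⟨⟨k, by omega⟩, rfl⟩
    have hvB : v ∉ B := fun h => lt_irrefl _ (hBk v h)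
    have hcost : stepCost n * (m + 1) = stepCost n * m + stepCost n := by ring
    have hcostn : stepCost n * (m + 1) ≤ stepCost n * n :=
      Nat.mul_le_mul_left _ (by omega)
    have hDn : stepCost n * (n + 1) = stepCost n * n + stepCost n := by ring
    have hstep6 : 6 ≤ stepCost n := by unfold stepCost; omega
    have hlt : ∀ w : Fin n, w.val < v.val + 1 ↔ w.val < v.val ∨ w = v := fun w => by
      rw [Nat.lt_succ_iff, le_iff_lt_or_eq, Fin.ext_iff]
    have hagree : ∀ A : Finset (Fin n), (∀ w : Fin n, w.val < v.val + 1 → (w ∈ A ↔ w ∈ B)) ↔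
        (∀ w : Fin n, w.val < v.val → (w ∈ A ↔ w ∈ B)) ∧ v ∉ A := by
      intro A
      refine ⟨fun h => ⟨fun w hw => h w (by omega), fun h' => hvB ((h v (by omega)).mp h')⟩,
        fun h w hw => ?_⟩
      rcases (hlt w).mp hw with hw | rfl
      · exact h.1 w hw
      · simp [h.2, hvB]
    have hagree' : ∀ A : Finset (Fin n),
        (∀ w : Fin n, w.val < v.val + 1 → (w ∈ A ↔ w ∈ insert v B)) ↔
        (∀ w : Fin n, w.val < v.val → (w ∈ A ↔ w ∈ B)) ∧ v ∈ A := by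
      intro A
      have hne : ∀ w : Fin n, w.val < v.val → w ≠ v := fun w hw h => by simp [h] at hw
      refine ⟨fun h => ⟨fun w hw => ?_, (h v (by omega)).mpr (Finset.mem_insert_self _ _)⟩,
        fun h w hw => ?_⟩
      · rw [h w (by omega)]; simp [hne w hw]
      · rcases (hlt w).mp hw with hw | rfl
        · rw [h.1 w hw]; simp [hne w hw]
        · simp [h.2]
    obtain ⟨L₁, hnd₁, hmem₁, hrun₁⟩ :=
      ih (v + 1) (by omega) B (fun w hw => (hBk w hw).trans (Nat.lt_succ_self _)) hB
    by_cases hB' : HasPrivateNeighbors G Finset.univ (insert v B)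
    · obtain ⟨L₂, hnd₂, hmem₂, hrun₂⟩ := ih (v + 1) (by omega) (insert v B) (fun w hw => by
        rcases Finset.mem_insert.mp hw with rfl | hw
        · exact Nat.lt_succ_self _
        · exact (hBk w hw).trans (Nat.lt_succ_self _)) hB'
      -- The sets avoiding `v` are printed before `insert v B` and the further sets containing `v`;
      -- then `v` is erased again.
      refine ⟨L₁ ++ insert v B :: L₂, ?_, ?_, ?_⟩
      · refine List.nodup_append'.mpr ⟨hnd₁, List.nodup_cons.mpr ⟨fun h => ?_, hnd₂⟩, ?_⟩
        · exact ((hmem₂ _).mp h).2.1 rfl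
        · intro A h1 h2
          have hvA := ((hagree A).mp ((hmem₁ A).mp h1).2.2).2
          rcases List.mem_cons.mp h2 with rfl | h2
          · exact hvA (Finset.mem_insert_self _ _)
          · exact hvA ((hagree' A).mp ((hmem₂ A).mp h2).2.2).2
      · intro A
        rw [List.mem_append, List.mem_cons, hmem₁, hmem₂, hagree, hagree']
        by_cases hvA : v ∈ A
        · have hAB : A ≠ B := fun h => hvB (h ▸ hvA)
          by_cases hAB' : A = insert v B
          · subst hAB'
            have := ((hagree' (insert v B)).mp fun _ _ => Iff.rfl).1
            tauto
          · tauto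
        · have hAB' : A ≠ insert v B := fun h => hvA (h ▸ Finset.mem_insert_self _ _)
          tauto
      · intro L' Q hQ s d hs hd
        have hlist : (L₁ ++ insert v B :: L₂).map (fun A => encode (rdfOf G A)) ++ L' =
            L₁.map (fun A => encode (rdfOf G A)) ++ ([encode (rdfOf G (insert v B))] ++
              (L₂.map (fun A => encode (rdfOf G A)) ++ L')) := by simp
        rw [hlist]
        refine hrun₁ _ Q (fun s₁ d₁ hs₁ hd₁ => ?_) s d hs hd
        refine Yields.loopStep (by simp [Expr.eval, hs₁.pos])
          ((yields_backtrackStep_of_success hM hs₁ hvB hB' (by omega)).mono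
            fun s₂ d₂ _ h₂ => hrun₂ L' Q (fun s₃ d₃ hs₃ hd₃ => ?_) s₂ d₂ h₂.1 h₂.2.le)
        refine Yields.loopStep (L := []) (by simp [Expr.eval, hs₃.pos])
          ((yields_backtrackStep_of_mem hM hs₃ (Finset.mem_insert_self _ _)).mono
            fun s₄ d₄ _ h₄ => hQ s₄ d₄ ?_ (by omega))
        have := h₄.1
        rwa [Finset.erase_insert hvB] at this
    -- By heredity, an admissible extension containing `v` would make `insert v B` admissible, so
    -- none is lost.
    · refine ⟨L₁, hnd₁, fun A => ?_, fun L' Q hQ s d hs hd => ?_⟩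
      · rw [hmem₁, hagree]
        refine ⟨fun h => ⟨h.1, h.2.1, h.2.2.1⟩, fun h => ⟨h.1, h.2.1, h.2.2, fun hvA => hB' ?_⟩⟩
        refine h.1.mono fun w hw => ?_
        rcases Finset.mem_insert.mp hw with rfl | hw
        · exact hvA
        · exact (h.2.2 w (hBk w hw)).mpr hw
      · refine hrun₁ L' Q (fun s₁ d₁ hs₁ hd₁ => ?_) s d hs hd
        refine Yields.loopStep (L := []) (by simp [Expr.eval, hs₁.pos])
          ((yields_backtrackStep_of_notMem hM hs₁ hvB hB').mono
            fun s₂ d₂ _ h₂ => hQ s₂ d₂ h₂.1 (by omega))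

/-- Print all minimal Roman dominating functions. -/
def enumerate : Program :=
  .seq check (.seq (.output 2 (.var 0)) (.seq (.assign 1 (.var 0)) (.loop (.var 1) backtrackStep)))

theorem holds_inputState : Holds G 0 ∅ (inputState G) := by
  refine ⟨rfl, rfl, fun u v => ?_, fun v => by simp [inputState]⟩
  -- Division by `n` with remainder recovers the pair from its address.
  have hiff : (∃ u' v' : Fin n, u.val * n + v.val = u'.val * n + v'.val ∧ G.Adj u' v') ↔
      G.Adj u v := by
    refine ⟨?_, fun h => ⟨u, v, rfl, h⟩⟩
    rintro ⟨u', v', he, h⟩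
    have hn : 0 < n := v.pos
    have hu : u = u' := Fin.ext (by
      have := congrArg (· / n) he
      simpa [Nat.add_div_of_dvd_right (Dvd.intro_left _ rfl), Nat.mul_div_cancel _ hn,
        Nat.div_eq_of_lt] using this)
    subst hu
    have hv : v = v' := Fin.ext (by omega)
    rwa [hv]
  by_cases hA : G.Adj u v
  · rw [if_pos hA]; exact if_pos ⟨rfl, hiff.mpr hA⟩
  · rw [if_neg hA]; exact if_neg fun h => hA (hiff.mp h.2)

theorem boundedBy_inputState (hM : n * n + n + 2 ≤ M) : (inputState G).BoundedBy M := by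
  constructor
  · intro x
    simp only [inputState]
    split_ifs <;> omega
  · intro a j hj
    simp only [inputState, ne_eq, ite_eq_right_iff, Classical.not_imp] at hj ⊢
    obtain ⟨⟨-, u, v, rfl, -⟩, -⟩ := hj
    have := index_lt u.isLt v.isLt
    refine ⟨by omega, ?_⟩
    split_ifs <;> omega

theorem exists_list_yields_enumerate (hM : n * n + n + 2 ≤ M)
    (hD : 2 + stepCost n * (n + 1) + n ≤ D) :
    ∃ L : List (Finset (Fin n)), L.Nodup ∧
      (∀ A, A ∈ L ↔ HasPrivateNeighbors G Finset.univ A) ∧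
      Yields M D enumerate (inputState G) 0 (L.map fun A => encode (rdfOf G A))
        fun _ d => d ≤ D := by
  have hemp : HasPrivateNeighbors G Finset.univ ∅ := by simp [HasPrivateNeighbors]
  obtain ⟨L, hnd, hmem, hrun⟩ := exists_list_yields_loop (G := G) (D := D) hM (by omega) n 0 (by omega) ∅
    (by simp) hemp
  have hDn : stepCost n * (n + 1) = stepCost n * n + stepCost n := by ring
  have hstep : 20 * (n + 1) ^ 2 + 6 = stepCost n := rfl
  -- The loop prints only sets other than its starting set, so the function of the empty set,
  -- constantly 1, is printed beforehand.
  refine ⟨∅ :: L, List.nodup_cons.mpr ⟨fun h => ((hmem ∅).mp h).2.1 rfl, hnd⟩, fun A => ?_, ?_⟩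
  · rw [List.mem_cons, hmem]
    by_cases hA : A = ∅
    · simp [hA, hemp]
    · simp [hA]
  · rw [List.map_cons]
    refine Yields.seq (L := []) ((yields_check hM holds_inputState).mono
      fun s₁ d₁ _ h₁ => Yields.seq (L := [_]) ?_)
    obtain ⟨hd₁, k1, k2, -⟩ := h₁
    rw [← output_eq_encode k1 k2]
    refine Yields.output (by simp only [Expr.eval, k1.order]; omega) ?_
    refine Yields.seq (L := []) (Yields.assign (by simp only [Expr.eval, k1.order]; omega) ?_)
    have := hrun [] (fun _ d => d ≤ D) (fun s d hs hd =>
      Yields.loopDone (by simp [Expr.eval, hs.pos]) (by omega)) _ 1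
      (by simpa only [Expr.eval, k1.order] using k1.setVar_one n) le_rfl
    rw [List.append_nil] at this
    simpa only [Expr.eval, k1.order] using this

end Enumeration

/-! ### The main theorem -/

theorem encode_injective {n : ℕ} : Function.Injective (encode (n := n)) := by
  intro f g h
  funext v
  exact Fin.ext (congrFun (List.ofFn_injective h) v)

/-- Since `1.89 / 1.894 < 1`, the geometric decay beats the cube. The bounded sequence is used at
index `n + 1`, whence the extra factor in the witness. -/
theorem exists_cube_mul_pow_le :
    ∃ K : ℝ, ∀ n : ℕ, ((n : ℝ) + 1) ^ 3 * (189 / 100) ^ n ≤ K * (1.8940 : ℝ) ^ n := by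
  obtain ⟨B, hB⟩ := (tendsto_pow_const_mul_const_pow_of_abs_lt_one 3
    (r := (189 / 100 : ℝ) / 1.8940) (by rw [abs_lt]; norm_num)).bddAbove_range
  refine ⟨B * (1.8940 / (189 / 100)), fun n => ?_⟩
  have h : (((n + 1 : ℕ) : ℝ)) ^ 3 * ((189 / 100 : ℝ) / 1.8940) ^ (n + 1) ≤ B :=
    hB ⟨n + 1, rfl⟩
  rw [div_pow, mul_div_assoc', div_le_iff₀ (by positivity), pow_succ (189 / 100 : ℝ),
    pow_succ (1.8940 : ℝ)] at h
  push_cast at h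
  have h' := div_le_div_of_nonneg_right h (by norm_num : (0 : ℝ) ≤ 189 / 100)
  calc ((n : ℝ) + 1) ^ 3 * (189 / 100) ^ n
      = ((n : ℝ) + 1) ^ 3 * ((189 / 100) ^ n * (189 / 100)) / (189 / 100) := by ring
    _ ≤ B * (1.8940 ^ n * 1.8940) / (189 / 100) := h'
    _ = B * (1.8940 / (189 / 100)) * 1.8940 ^ n := by ring

end RomanEnum

theorem mainTheorem3 :
    ∃ (P : RomanEnum.Program) (C : ℝ) (delayBound spaceBound : Polynomial ℕ),
      ∀ (n : ℕ) (G : SimpleGraph (Fin n)), RomanEnum.IsChordal G →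
        ∃ (t : List RomanEnum.Event) (s : RomanEnum.State),
          RomanEnum.Exec P (RomanEnum.inputState G) t s ∧
          RomanEnum.EnumeratesMinimalRDFs G (RomanEnum.outputs t) ∧
          (RomanEnum.time t : ℝ) ≤ C * (1.8940 : ℝ) ^ n ∧
          (∀ d ∈ RomanEnum.delays 0 t, d ≤ delayBound.eval n) ∧
          RomanEnum.SpaceAtMost t (spaceBound.eval n) := by
  obtain ⟨K, hK⟩ := RomanEnum.exists_cube_mul_pow_le
  -- The cubic delay covers about `n + 1` steps of quadratic cost. The factor 100 is this 50 times
  -- 2, from bounding the number of outputs plus one by `2 * 1.89 ^ n`.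
  refine ⟨RomanEnum.enumerate, 100 * K, 50 * (Polynomial.X + 1) ^ 3,
    Polynomial.X * Polynomial.X + Polynomial.X + 2, fun n G hG => ?_⟩
  have hspace : (Polynomial.X * Polynomial.X + Polynomial.X + 2 : Polynomial ℕ).eval n =
      n * n + n + 2 := by simp
  have hdelay : (50 * (Polynomial.X + 1) ^ 3 : Polynomial ℕ).eval n = 50 * (n + 1) ^ 3 := by simp
  rw [hspace, hdelay]
  obtain ⟨L, hnd, hmem, hrun⟩ := RomanEnum.exists_list_yields_enumerate (G := G)
    (M := n * n + n + 2) (D := 50 * (n + 1) ^ 3) le_rfl (by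
      unfold RomanEnum.stepCost
      nlinarith [Nat.zero_le (n ^ 3), Nat.zero_le (n ^ 2)])
  obtain ⟨t, s, hexec, hout, htick, -, l, d, hd, hl, hdD⟩ :=
    hrun (RomanEnum.boundedBy_inputState le_rfl)
  have hdel : ∀ d ∈ RomanEnum.delays 0 t, d ≤ 50 * (n + 1) ^ 3 := by
    intro x hx
    rw [hd, List.mem_append, List.mem_singleton] at hx
    rcases hx with hx | rfl
    · exact hl x hx
    · exact hdD
  refine ⟨t, s, hexec, ⟨?_, fun w => ?_⟩, ?_, hdel, fun s' hs' => (htick s' hs').fitsIn⟩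
  · rw [hout]
    exact hnd.map (RomanEnum.encode_injective.comp RomanEnum.rdfOf_injective)
  · rw [hout, List.mem_map]
    constructor
    · rintro ⟨A, hA, rfl⟩
      exact ⟨_, RomanEnum.isMinimalRDF_rdfOf ((hmem A).mp hA), rfl⟩
    · rintro ⟨f, hf, rfl⟩
      obtain ⟨A, hA, rfl⟩ := hf.exists_rdfOf
      exact ⟨A, (hmem A).mpr hA, rfl⟩
  · have htime := RomanEnum.time_le_of_delays_le hdel
    have hcount : (L.length : ℝ) ≤ (189 / 100) ^ n := by
      have := hG.card_hasPrivateNeighbors_le L.toFinset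
        fun A hA => (hmem A).mp (List.mem_toFinset.mp hA)
      rwa [List.toFinset_card_of_nodup hnd, Fintype.card_fin] at this
    rw [hout, List.length_map] at htime
    have htime' : (RomanEnum.time t : ℝ) ≤ ((L.length : ℝ) + 1) * (50 * ((n : ℝ) + 1) ^ 3) := by
      exact_mod_cast htime
    have hone : (1 : ℝ) ≤ (189 / 100) ^ n := one_le_pow₀ (by norm_num)
    have hcube : (0 : ℝ) ≤ 50 * ((n : ℝ) + 1) ^ 3 := by positivity
    calc (RomanEnum.time t : ℝ) ≤ ((L.length : ℝ) + 1) * (50 * ((n : ℝ) + 1) ^ 3) := htime'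
      _ ≤ (2 * (189 / 100) ^ n) * (50 * ((n : ℝ) + 1) ^ 3) :=
        mul_le_mul_of_nonneg_right (by linarith) hcube
      _ = 100 * (((n : ℝ) + 1) ^ 3 * (189 / 100) ^ n) := by ring
      _ ≤ 100 * (K * (1.8940 : ℝ) ^ n) := by linarith [hK n]
      _ = 100 * K * (1.8940 : ℝ) ^ n := by ring
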